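/- A finite sequence $a_1a_2\cdots a_\ell$ is $r$-sparse if $a_i\ne a_j$ whenever $1\le |i-j|\le r-1$. An $(r,s)$-formation is a concatenation of $s$ permutations of one set of $r$ distinct symbols. For $r\ge 1$ and $s\ge 4$ let $F_{r,s}(n)$ denote the maximum length of an $r$-sparse sequence with exactly $n$ distinct symbols that contains no $(r,s)$-formation as a (not necessarily contiguous) subsequence. Let $A_1(n)=2n$ and, for $k\ge 2$, let $A_k(n)=A_{k-1}^{(n)}(1)$ be the $n$-fold iterate of $A_{k-1}$ applied to $1$. Let $\alpha(x)=\min\{k\ge 1 : A_k(3)\ge x\}$ be the inverse Ackermann function. **Theorem.** Let $r\ge 1$ and $s\ge 4$ be integers and let $t=\lfloor (s-3)/2\rfloor$. Then the maximum $F_{r,s}(n)$ exists (is finite) for every $n\ge 0$, and there is a constant $C$ depending only on $r$ and $s$ such that, for all integers $n\ge 0$, $$F_{r,s}(n)\le n\cdot 2^{\frac{1}{t!}\alpha(n)^t + C\,\alpha(n)^{t-1}}\quad\text{if } s \text{ is odd},$$ $$F_{r,s}(n)\le n\cdot 2^{\frac{1}{t!}\alpha(n)^t\log_2\alpha(n)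 + C\,\alpha(n)^{t}}\quad\text{if } s \text{ is even}.$$ -/

import Mathlib

namespace FormationFree

/-- The Ackermann hierarchy `A_k`, `k ≥ 1`: `A_1(n) = 2n` and, for `k ≥ 2`, `A_k(n)` is the
`n`-fold iterate of `A_{k-1}` applied to `1`. The value at `k = 0` is a placeholder, never used. -/
def ackHier : ℕ → ℕ → ℕ
  | 0 => fun _ => 0
  | 1 => fun n => 2 * n
  | k + 2 => fun n => (ackHier (k + 1))^[n] 1

/-- The Ackermann function `A(k) = A_k(3)`, `k ≥ 1`. -/
def ackFun (k : ℕ) : ℕ := ackHier k 3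

/-- The inverse Ackermann function `α(x) = min {k ≥ 1 | A(k) ≥ x}`. -/
noncomputable def invAck (x : ℕ) : ℕ := sInf {k : ℕ | 1 ≤ k ∧ x ≤ ackFun k}

/-- A finite sequence is `r`-sparse if any two of its entries at distance between `1` and `r - 1`
are distinct. -/
def IsSparse (r : ℕ) (S : List ℕ) : Prop :=
  ∀ (i j : ℕ) (hi : i < S.length) (hj : j < S.length), i < j → j < i + r → S[i] ≠ S[j]

/-- An `(r,s)`-formation: the concatenation of `s` permutations of one and the same set of `r`
distinct symbols. -/
def IsFormation (r s : ℕ) (L : List ℕ) : Prop :=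
  ∃ (A : Finset ℕ) (P : List (List ℕ)), A.card = r ∧ P.length = s ∧
    (∀ p ∈ P, p.Nodup ∧ p.toFinset = A) ∧ L = P.flatten

/-- A sequence that is `r`-sparse and contains no `(r,s)`-formation as a (not necessarily
contiguous) subsequence. -/
def IsFormationFree (r s : ℕ) (S : List ℕ) : Prop :=
  IsSparse r S ∧ ∀ L : List ℕ, IsFormation r s L → ¬ L.Sublist S

/-- The lengths of the `(r,s)`-formation-free sequences on `n` distinct symbols. -/
def formationFreeLengths (r s n : ℕ) : Set ℕ :=
  {l : ℕ | ∃ S : List ℕ, IsFormationFree r s S ∧ S.toFinset.card = n ∧ S.length = l}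

/-- `F_{r,s}(n)`, the maximum length of an `(r,s)`-formation-free sequence on `n` distinct
symbols. -/
noncomputable def maxLength (r s n : ℕ) : ℕ := sSup (formationFreeLengths r s n)

end FormationFree

namespace FormationFree

open Finset

/-! The argument separates the order of letters from the number of blocks in which they occur. Cut a
sequence into blocks and attach to each symbol the set of indices of the blocks containing it. If
`r` of these sets were `s`-fold interleaved, picking one permutation per round would give an
`(r,s)`-formation. So it suffices to bound interleaving-free families of sets of positions.

Such families are treated dually: fix a multiplicity `K` and bound the number of sets with more than
`K` positions below `m`. In `FamilyBound.recurrence` the positions are grouped into layers. A set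
concentrated in one layer is handled locally; a set large in its first or last layer leaves a
position outside on one side, which lowers the interleaving order by one; a set large in a middle
layer lowers it by two; a set meeting many layers is handled one level down, with layers as
positions. Otherwise the set is small. Iterating with layer sizes of Ackermann growth
(`familyBound_blockCount`, `exists_ackHier_le`) shows that at level `d = α(n)` only linearly many
sets exceed `multiplicity s d`, with a constant independent of `d`.

For the sequence itself, `IsFormationFree.length_le` cuts it into at most `2n + 1` blocks that are
nearly free of `(r,s-2)`-formations. Hence the length factor for `s` is that for `s - 2` times
`multiplicity s (α n)`, up to constants. The former factor only affects the lower-order term of the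
exponent. Unrolling the recurrence in `d`, the exponent of `multiplicity s` is to leading order the
sum over levels of that of `multiplicity (s - 2)`, starting from `4d + 2` for `s = 4` and order
`2^d` for `s = 5`; repeated summation produces `1/t!`, and the even case inherits the logarithm. -/

/-! ### Interleaved families of sets of positions -/

/-- `x` exhibits the members of `A` as `s`-fold interleaved in the family `X` of sets of positions:
the `i`-th chosen positions all precede the `j`-th ones for `i < j`. -/
def IsInterleaving {α : Type} (s : ℕ) (A : Finset α) (X : α → Finset ℕ) (x : ℕ → α → ℕ) : Prop :=
  (∀ i < s, ∀ a ∈ A, x i a ∈ X a) ∧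
    ∀ i j, i < j → j < s → ∀ a ∈ A, ∀ b ∈ A, x i a < x j b

/-- No `r` members of the family `X` indexed by `V` are `s`-fold interleaved. -/
def InterleavingFree {α : Type} (r s : ℕ) (V : Finset α) (X : α → Finset ℕ) : Prop :=
  ∀ A ⊆ V, A.card = r → ∀ x, ¬ IsInterleaving s A X x

/-- Every family of sets of more than `K` positions below `m` without `r` members that are
`s`-fold interleaved has at most `N` members. -/
def FamilyBound (r s K m N : ℕ) : Prop :=
  ∀ (α : Type) (V : Finset α) (X : α → Finset ℕ), InterleavingFree r s V X →
    (∀ a ∈ V, X a ⊆ range m) → (∀ a ∈ V, K < (X a).card) → V.card ≤ N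

theorem InterleavingFree.mono {α : Type} {r s : ℕ} {V W : Finset α} {X Y : α → Finset ℕ}
    (h : InterleavingFree r s V X) (hW : W ⊆ V) (hY : ∀ a ∈ W, Y a ⊆ X a) :
    InterleavingFree r s W Y := fun A hA hr x hx =>
  h A (hA.trans hW) hr x ⟨fun i hi a ha => hY a (hA ha) (hx.1 i hi a ha), hx.2⟩

/-- A monotone map reflects strict inequalities, so an interleaving of the images lifts to
preimages. This serves both for translating a layer and for replacing positions by layer indices. -/
theorem InterleavingFree.image {α : Type} {r s : ℕ} {V : Finset α} {X : α → Finset ℕ}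
    (h : InterleavingFree r s V X) {f : ℕ → ℕ} (hf : Monotone f) :
    InterleavingFree r s V (fun a => (X a).image f) := by
  intro A hA hr x hx
  have key : ∀ i a, ∃ y, i < s → a ∈ A → y ∈ X a ∧ f y = x i a := by
    intro i a
    by_cases hi : i < s ∧ a ∈ A
    · obtain ⟨y, hy, hyx⟩ := Finset.mem_image.1 (hx.1 i hi.1 a hi.2)
      exact ⟨y, fun _ _ => ⟨hy, hyx⟩⟩
    · exact ⟨0, fun h1 h2 => (hi ⟨h1, h2⟩).elim⟩
  choose y hy using key
  refine h A hA hr y ⟨fun i hi a ha => (hy i a hi ha).1, fun i j hij hj a ha b hb => ?_⟩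
  have := hx.2 i j hij hj a ha b hb
  rw [← (hy i a (hij.trans hj) ha).2, ← (hy j b hj hb).2] at this
  exact hf.reflect_lt this

/-- If every member of `V` has a position of `Y` above all positions of `X`, the interleaving
order drops by one. -/
theorem InterleavingFree.of_later {α : Type} {r s : ℕ} {V W : Finset α} {X Y : α → Finset ℕ}
    (h : InterleavingFree r (s + 1) V X) (hW : W ⊆ V) (hY : ∀ a ∈ W, Y a ⊆ X a)
    (hl : ∀ a ∈ W, ∃ y ∈ X a, ∀ b ∈ W, ∀ z ∈ Y b, z < y) : InterleavingFree r s W Y := by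
  intro A hA hr x hx
  choose! y hy hy' using hl
  refine h A (hA.trans hW) hr (fun i a => if i < s then x i a else y a) ⟨?_, ?_⟩
  · intro i hi a ha
    by_cases his : i < s
    · simpa [his] using hY a (hA ha) (hx.1 i his a ha)
    · simpa [his] using hy a (hA ha)
  · intro i j hij hj a ha b hb
    have hi : i < s := by omega
    by_cases hjs : j < s
    · simpa [hi, hjs] using hx.2 i j hij hjs a ha b hb
    · simpa [hi, hjs] using hy' b (hA hb) a (hA ha) _ (hx.1 i hi a ha)

/-- If every member of `V` has a position of `Y` below all positions of `X`, the interleaving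
order drops by one. -/
theorem InterleavingFree.of_earlier {α : Type} {r s : ℕ} {V W : Finset α} {X Y : α → Finset ℕ}
    (h : InterleavingFree r (s + 1) V X) (hW : W ⊆ V) (hY : ∀ a ∈ W, Y a ⊆ X a)
    (hl : ∀ a ∈ W, ∃ y ∈ X a, ∀ b ∈ W, ∀ z ∈ Y b, y < z) : InterleavingFree r s W Y := by
  intro A hA hr x hx
  choose! y hy hy' using hl
  refine h A (hA.trans hW) hr (fun i a => if i = 0 then y a else x (i - 1) a) ⟨?_, ?_⟩
  · intro i hi a ha
    by_cases his : i = 0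
    · simpa [his] using hy a (hA ha)
    · simpa [his] using hY a (hA ha) (hx.1 (i - 1) (by omega) a ha)
  · intro i j hij hj a ha b hb
    have hj0 : j ≠ 0 := by omega
    by_cases his : i = 0
    · simpa [his, hj0] using hy' a (hA ha) b (hA hb) _ (hx.1 (j - 1) (by omega) b hb)
    · simpa [his, hj0] using hx.2 (i - 1) (j - 1) (by omega) (by omega) a ha b hb

theorem FamilyBound.mono {r s K m N N' : ℕ} (h : FamilyBound r s K m N) (hN : N ≤ N') :
    FamilyBound r s K m N' := fun α V X h1 h2 h3 => (h α V X h1 h2 h3).trans hN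

/-- A family whose members contain too few positions is empty. -/
theorem FamilyBound.of_le {r s K m : ℕ} (N : ℕ) (h : m ≤ K) : FamilyBound r s K m N := by
  intro α V X _ h2 h3
  rcases V.eq_empty_or_nonempty with rfl | ⟨a, ha⟩
  · simp
  · have := (card_le_card (h2 a ha)).trans_eq (card_range m)
    have := h3 a ha
    omega

/-! ### Base cases: two-fold and three-fold interleavings -/

theorem card_le_of_fiber_bound {α : Type} {r m : ℕ} (V : Finset α) (p : α → ℕ)
    (hp : ∀ a ∈ V, p a < m) (hr : 1 ≤ r)
    (h : ∀ q, ∀ A ⊆ V, A.card = r → ¬ ∀ a ∈ A, p a = q) : V.card ≤ (r - 1) * m := by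
  classical
  by_contra hc
  push Not at hc
  obtain ⟨q, _, hq⟩ := exists_lt_card_fiber_of_mul_lt_card_of_maps_to (s := V) (t := range m)
    (f := p) (n := r - 1) (fun a ha => mem_range.2 (hp a ha))
    (by rw [card_range, mul_comm]; exact hc)
  obtain ⟨A, hA, hAr⟩ := exists_subset_card_eq
    (show r ≤ (V.filter (fun a => p a = q)).card by omega)
  exact h q A (hA.trans (filter_subset _ _)) hAr fun a ha => (mem_filter.1 (hA ha)).2

/-- If `r` members shared their upper chosen position `y`, every lower position would precede this
common value, a two-fold interleaving. -/
theorem familyBound_two {r : ℕ} (hr : 1 ≤ r) (m : ℕ) : FamilyBound r 2 1 m ((r - 1) * m) := by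
  intro α V X h h2 h3
  have key : ∀ a ∈ V, ∃ x ∈ X a, ∃ y ∈ X a, x < y := by
    intro a ha
    obtain ⟨x, hx, y, hy, hxy⟩ := one_lt_card.1 (h3 a ha)
    rcases lt_or_gt_of_ne hxy with h' | h'
    · exact ⟨x, hx, y, hy, h'⟩
    · exact ⟨y, hy, x, hx, h'⟩
  choose! x hx y hy hxy using key
  refine card_le_of_fiber_bound V y (fun a ha => mem_range.1 (h2 a ha (hy a ha))) hr ?_
  intro q A hA hAr hq
  refine h A hA hAr (fun i a => if i = 0 then x a else y a) ⟨?_, ?_⟩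
  · intro i _ a ha
    by_cases h0 : i = 0
    · simpa [h0] using hx a (hA ha)
    · simpa [h0] using hy a (hA ha)
  · intro i j hij hj a ha b hb
    obtain rfl : i = 0 := by omega
    obtain rfl : j = 1 := by omega
    have := hxy a (hA ha)
    simp only [if_true, one_ne_zero, if_false]
    rw [hq b hb, ← hq a ha]
    exact this

/-- A middle position shared by `r` members separates all their lower positions from all their upper
ones. -/
theorem familyBound_three {r : ℕ} (hr : 1 ≤ r) (m : ℕ) :
    FamilyBound r 3 2 m ((r - 1) * m) := by
  intro α V X h h2 h3
  have key : ∀ a ∈ V, ∃ x ∈ X a, ∃ y ∈ X a, ∃ z ∈ X a, x < y ∧ y < z := by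
    intro a ha
    obtain ⟨x, y, z, hx, hy, hz, h1, h2, h3⟩ := two_lt_card_iff.1 (h3 a ha)
    rcases lt_or_gt_of_ne h1 with h1 | h1 <;> rcases lt_or_gt_of_ne h2 with h2 | h2 <;>
      rcases lt_or_gt_of_ne h3 with h3 | h3
    · exact ⟨x, hx, y, hy, z, hz, h1, h3⟩
    · exact ⟨x, hx, z, hz, y, hy, h2, h3⟩
    · omega
    · exact ⟨z, hz, x, hx, y, hy, h2, h1⟩
    · exact ⟨y, hy, x, hx, z, hz, h1, h2⟩
    · omega
    · exact ⟨y, hy, z, hz, x, hx, h3, h2⟩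
    · exact ⟨z, hz, y, hy, x, hx, h3, h1⟩
  choose! x hx y hy z hz hxy hyz using key
  refine card_le_of_fiber_bound V y (fun a ha => mem_range.1 (h2 a ha (hy a ha))) hr ?_
  intro q A hA hAr hq
  have e : ∀ a ∈ A, ∀ b ∈ A, x a < y b ∧ y a < z b := fun a ha b hb => by
    have h1 := hxy a (hA ha)
    have h2 := hyz b (hA hb)
    rw [hq a ha] at h1 ⊢
    rw [hq b hb] at h2 ⊢
    exact ⟨h1, h2⟩
  refine h A hA hAr (fun i a => if i = 0 then x a else if i = 1 then y a else z a) ⟨?_, ?_⟩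
  · intro i _ a ha
    by_cases h0 : i = 0
    · simpa [h0] using hx a (hA ha)
    · by_cases h1 : i = 1
      · simpa [h0, h1] using hy a (hA ha)
      · simpa [h0, h1] using hz a (hA ha)
  · intro i j hij hj a ha b hb
    have := e a ha b hb
    have := hxy b (hA hb)
    obtain ⟨rfl, rfl⟩ | ⟨rfl, rfl⟩ | ⟨rfl, rfl⟩ :
      (i = 0 ∧ j = 1) ∨ (i = 0 ∧ j = 2) ∨ (i = 1 ∧ j = 2) := by omega
    all_goals
      simp only [if_true, one_ne_zero, if_false, OfNat.ofNat_ne_zero, OfNat.ofNat_ne_one]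
      have := hyz b (hA hb)
      omega

/-! ### The layering recurrence -/

theorem sum_min_layers (t m M : ℕ) :
    ∑ i ∈ range M, min t (m - i * t) = min (M * t) m := by
  induction M with
  | zero => simp
  | succ M ih => rw [sum_range_succ, ih, Nat.succ_mul]; omega

/-- Members with more than `K` positions in the layer `[i * t, (i + 1) * t)`. -/
theorem FamilyBound.layer {r s K m t c : ℕ}
    (h : ∀ l ≤ t, FamilyBound r s K l (c * l)) {α : Type} (W : Finset α) (X : α → Finset ℕ)
    (hX : ∀ a ∈ W, X a ⊆ range m) (i : ℕ) (ht : 0 < t)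
    (hf : InterleavingFree r s W (fun a => (X a).filter (fun x => x / t = i)))
    (hK : ∀ a ∈ W, K < ((X a).filter (fun x => x / t = i)).card) :
    W.card ≤ c * min t (m - i * t) := by
  have hdiv : ∀ x, x / t = i → i * t ≤ x ∧ x < i * t + t := by
    intro x hx
    have := Nat.mod_lt x ht
    have := Nat.div_add_mod x t
    rw [hx, mul_comm] at this
    omega
  refine h _ (min_le_left _ _) α W _ (hf.image (f := fun x => x - i * t)
    (fun x y hxy => Nat.sub_le_sub_right hxy _)) ?_ ?_
  · intro a ha y hy
    obtain ⟨x, hx, rfl⟩ := mem_image.1 hy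
    obtain ⟨hx1, hx2⟩ := mem_filter.1 hx
    have := hdiv x hx2
    have := mem_range.1 (hX a ha hx1)
    rw [mem_range]
    omega
  · intro a ha
    rw [card_image_of_injOn]
    · exact hK a ha
    · intro x hx y hy hxy
      have h1 := hdiv x (mem_filter.1 hx).2
      have h2 := hdiv y (mem_filter.1 hy).2
      simp only at hxy
      omega

theorem lt_of_div_lt {t x y : ℕ} (h : x / t < y / t) : x < y := by
  by_contra hc
  exact absurd (Nat.div_le_div_right (c := t) (not_lt.1 hc)) (not_le.2 h)

/-- A member that is not exceptional meets at most `K₃` layers, with at most `K₂` positions in each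
and up to `K₁` more in the first and in the last, hence at most `K` in all. The exceptional members
of each layer are charged to its true size, so these charges add up to a multiple of `m`. -/
theorem FamilyBound.recurrence {r s K K₁ K₂ K₃ t m M N c c₁ c₂ : ℕ} (ht : 0 < t)
    (hm : m ≤ M * t) (hK : 2 * K₁ + K₃ * K₂ ≤ K)
    (h : ∀ l ≤ t, FamilyBound r (s + 2) K l (c * l))
    (h₁ : ∀ l ≤ t, FamilyBound r (s + 1) K₁ l (c₁ * l))
    (h₂ : ∀ l ≤ t, FamilyBound r s K₂ l (c₂ * l))
    (h₃ : FamilyBound r (s + 2) K₃ M N) :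
    FamilyBound r (s + 2) K m ((c + 2 * c₁ + c₂) * m + N) := by
  classical
  intro α V X hf hX hc
  let lay : ℕ → α → Finset ℕ := fun i a => (X a).filter (fun x => x / t = i)
  let L : α → Finset ℕ := fun a => (X a).image (fun x => x / t)
  let V₀ : ℕ → Finset α := fun i => V.filter (fun a => K < (lay i a).card)
  let V₁ : ℕ → Finset α := fun i => V.filter (fun a => K₁ < (lay i a).card ∧ ∃ y ∈ X a, i < y / t)
  let V₂ : ℕ → Finset α := fun i => V.filter (fun a => K₁ < (lay i a).card ∧ ∃ y ∈ X a, y / t < i)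
  let V₃ : ℕ → Finset α := fun i => V.filter (fun a => K₂ < (lay i a).card ∧
    (∃ y ∈ X a, i < y / t) ∧ ∃ y ∈ X a, y / t < i)
  let V₄ : Finset α := V.filter (fun a => K₃ < (L a).card)
  have hlay : ∀ i a, lay i a ⊆ X a := fun i a => filter_subset _ _
  have d₀ : ∀ i, (V₀ i).card ≤ c * min t (m - i * t) := fun i =>
    FamilyBound.layer h (V₀ i) X (fun a ha => hX a (mem_filter.1 ha).1) i ht
      (hf.mono (filter_subset _ _) fun a _ => hlay i a) fun a ha => (mem_filter.1 ha).2
  have later : ∀ i (W : Finset α), (∀ a ∈ W, ∃ y ∈ X a, i < y / t) →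
      ∀ a ∈ W, ∃ y ∈ X a, ∀ b ∈ W, ∀ z ∈ lay i b, z < y := by
    intro i W hW a ha
    obtain ⟨y, hy, hiy⟩ := hW a ha
    exact ⟨y, hy, fun b _ z hz => lt_of_div_lt ((mem_filter.1 hz).2.trans_lt hiy)⟩
  have earlier : ∀ i (W : Finset α), (∀ a ∈ W, ∃ y ∈ X a, y / t < i) →
      ∀ a ∈ W, ∃ y ∈ X a, ∀ b ∈ W, ∀ z ∈ lay i b, y < z := by
    intro i W hW a ha
    obtain ⟨y, hy, hiy⟩ := hW a ha
    exact ⟨y, hy, fun b _ z hz => lt_of_div_lt (hiy.trans_eq (mem_filter.1 hz).2.symm)⟩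
  have d₁ : ∀ i, (V₁ i).card ≤ c₁ * min t (m - i * t) := fun i =>
    FamilyBound.layer h₁ (V₁ i) X (fun a ha => hX a (mem_filter.1 ha).1) i ht
      (hf.of_later (filter_subset _ _) (fun a _ => hlay i a)
        (later i _ fun a ha => (mem_filter.1 ha).2.2)) fun a ha => (mem_filter.1 ha).2.1
  have d₂ : ∀ i, (V₂ i).card ≤ c₁ * min t (m - i * t) := fun i =>
    FamilyBound.layer h₁ (V₂ i) X (fun a ha => hX a (mem_filter.1 ha).1) i ht
      (hf.of_earlier (filter_subset _ _) (fun a _ => hlay i a)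
        (earlier i _ fun a ha => (mem_filter.1 ha).2.2)) fun a ha => (mem_filter.1 ha).2.1
  have d₃ : ∀ i, (V₃ i).card ≤ c₂ * min t (m - i * t) := fun i => by
    refine FamilyBound.layer h₂ (V₃ i) X (fun a ha => hX a (mem_filter.1 ha).1) i ht ?_
      fun a ha => (mem_filter.1 ha).2.1
    -- The order drops twice. The first truncation keeps the layers below `i`, so that the earlier
    -- position needed for the second drop is still available.
    have h' : InterleavingFree r (s + 1) (V₃ i)
        (fun a => (X a).filter (fun x => x / t ≤ i)) := by
      refine hf.of_later (filter_subset _ _) (fun a _ => filter_subset _ _) fun a ha => ?_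
      obtain ⟨y, hy, hiy⟩ := (mem_filter.1 ha).2.2.1
      exact ⟨y, hy, fun b _ z hz => lt_of_div_lt ((mem_filter.1 hz).2.trans_lt hiy)⟩
    refine h'.of_earlier (subset_refl _) (fun a _ x hx => ?_) fun a ha => ?_
    · obtain ⟨hx1, hx2⟩ := mem_filter.1 hx
      exact mem_filter.2 ⟨hx1, hx2.le⟩
    · obtain ⟨y, hy, hiy⟩ := (mem_filter.1 ha).2.2.2
      exact ⟨y, mem_filter.2 ⟨hy, hiy.le⟩, fun b _ z hz =>
        lt_of_div_lt (hiy.trans_eq (mem_filter.1 hz).2.symm)⟩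
  have hL : ∀ a ∈ V, L a ⊆ range M := by
    intro a ha y hy
    obtain ⟨x, hx, rfl⟩ := mem_image.1 hy
    exact mem_range.2 ((Nat.div_lt_iff_lt_mul ht).2 ((mem_range.1 (hX a ha hx)).trans_le hm))
  have d₄ : V₄.card ≤ N := h₃ α V₄ L
    ((hf.image (f := fun x => x / t) fun x y hxy => Nat.div_le_div_right hxy).mono
      (filter_subset _ _) fun a _ => subset_refl _)
    (fun a ha => hL a (mem_filter.1 ha).1) fun a ha => (mem_filter.1 ha).2
  have cover : V ⊆ (range M).biUnion (fun i => V₀ i ∪ V₁ i ∪ V₂ i ∪ V₃ i) ∪ V₄ := by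
    intro a ha
    by_contra hn
    simp only [mem_union, mem_biUnion, not_or, not_exists, not_and] at hn
    obtain ⟨hn, h4⟩ := hn
    have h4 : (L a).card ≤ K₃ := by
      by_contra hc; exact h4 (mem_filter.2 ⟨ha, not_le.1 hc⟩)
    have hXne : (L a).Nonempty := by
      rw [image_nonempty, ← card_pos]
      exact (Nat.zero_le _).trans_lt (hc a ha)
    have hbd : ∀ i ∈ L a, (lay i a).card ≤ K₂ + (if i = (L a).min' hXne then K₁ else 0)
        + (if i = (L a).max' hXne then K₁ else 0) := by
      intro i hi
      obtain ⟨⟨⟨n0, n1⟩, n2⟩, n3⟩ := hn i (hL a ha hi)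
      obtain ⟨x, hx, hxt⟩ := mem_image.1 ((L a).min'_mem hXne)
      obtain ⟨y, hy, hyt⟩ := mem_image.1 ((L a).max'_mem hXne)
      have hmin := (L a).min'_le i hi
      have hmax := (L a).le_max' i hi
      by_cases e1 : i = (L a).min' hXne
      · by_cases e2 : i = (L a).max' hXne
        -- The first and last layers coincide, so the whole member lies in one layer and belongs to
        -- `V₀ i`.
        · exfalso
          refine n0 (mem_filter.2 ⟨ha, ?_⟩)
          rw [show lay i a = X a from filter_true_of_mem fun z hz => ?_]
          · exact hc a ha
          · have hz' : z / t ∈ L a := mem_image_of_mem _ hz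
            have := (L a).min'_le _ hz'
            have := (L a).le_max' _ hz'
            omega
        · have : (lay i a).card ≤ K₁ := by
            by_contra hcc
            exact n1 (mem_filter.2 ⟨ha, not_le.1 hcc, y, hy, by
              omega⟩)
          rw [if_pos e1]; omega
      · by_cases e2 : i = (L a).max' hXne
        · have : (lay i a).card ≤ K₁ := by
            by_contra hcc
            exact n2 (mem_filter.2 ⟨ha, not_le.1 hcc, x, hx, by
              omega⟩)
          rw [if_pos e2]; omega
        · have : (lay i a).card ≤ K₂ := by
            by_contra hcc
            exact n3 (mem_filter.2 ⟨ha, not_le.1 hcc, ⟨y, hy, by omega⟩,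
              x, hx, by omega⟩)
          omega
    have hsum : (X a).card = ∑ i ∈ L a, (lay i a).card :=
      card_eq_sum_card_fiberwise fun x hx => mem_image_of_mem _ hx
    have hsum2 := hsum.trans_le (sum_le_sum hbd)
    simp only [sum_add_distrib, sum_const, smul_eq_mul, sum_ite_eq', min'_mem, max'_mem,
      if_true] at hsum2
    have := hc a ha
    have := Nat.mul_le_mul_right K₂ h4
    omega
  have hsum : ∑ i ∈ range M, min t (m - i * t) = m := by
    rw [sum_min_layers, min_eq_right hm]
  calc V.card ≤ _ := card_le_card cover
    _ ≤ _ + V₄.card := card_union_le _ _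
    _ ≤ (∑ i ∈ range M, (V₀ i ∪ V₁ i ∪ V₂ i ∪ V₃ i).card) + N :=
      Nat.add_le_add card_biUnion_le d₄
    _ ≤ (∑ i ∈ range M, (c + 2 * c₁ + c₂) * min t (m - i * t)) + N := by
      refine Nat.add_le_add_right (sum_le_sum fun i _ => ?_) _
      have e1 := card_union_le (V₀ i ∪ V₁ i ∪ V₂ i) (V₃ i)
      have e2 := card_union_le (V₀ i ∪ V₁ i) (V₂ i)
      have e3 := card_union_le (V₀ i) (V₁ i)
      have := d₀ i; have := d₁ i; have := d₂ i; have := d₃ i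
      rw [add_mul, add_mul, mul_assoc 2]
      omega
    _ = _ := by rw [← mul_sum, hsum]

/-! ### Multiplicities and block counts of Ackermann growth -/

/-- Multiplicities `multiplicity s d` beyond which families without `s`-fold interleavings are of
linear size at the `d`-th level of the Ackermann hierarchy. -/
def multiplicity : ℕ → ℕ → ℕ
  | 0, _ => 0
  | 1, _ => 0
  | 2, _ => 1
  | 3, _ => 2
  | _ + 4, 0 => 2
  | s + 4, d + 1 =>
    2 * multiplicity (s + 3) (d + 1) + multiplicity (s + 4) d * multiplicity (s + 2) (d + 1)
  termination_by s d => (s, d)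

theorem multiplicity_succ (s d : ℕ) : multiplicity (s + 4) (d + 1) =
    2 * multiplicity (s + 3) (d + 1) + multiplicity (s + 4) d * multiplicity (s + 2) (d + 1) := by
  rw [multiplicity]

theorem multiplicity_zero (s : ℕ) : multiplicity (s + 4) 0 = 2 := by rw [multiplicity]

theorem multiplicity_two (d : ℕ) : multiplicity 2 d = 1 := by rw [multiplicity]

theorem multiplicity_three (d : ℕ) : multiplicity 3 d = 2 := by rw [multiplicity]

theorem two_le_multiplicity (s d : ℕ) : 2 ≤ multiplicity (s + 3) d := by
  induction s generalizing d with
  | zero => rw [multiplicity_three]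
  | succ s ih =>
    cases d with
    | zero => rw [multiplicity_zero]
    | succ d =>
      have := ih (d + 1)
      rw [multiplicity_succ]
      omega

/-- The largest `j` with `(E * (j + 1)) ^ p ≤ t`, if any. -/
def powInverse (E p t : ℕ) : ℕ := Nat.findGreatest (fun j => (E * (j + 1)) ^ p ≤ t) t

theorem powInverse_le (E p t : ℕ) : powInverse E p t ≤ t := Nat.findGreatest_le _

theorem powInverse_spec (E p t : ℕ) (h : powInverse E p t ≠ 0) :
    (E * (powInverse E p t + 1)) ^ p ≤ t :=
  Nat.findGreatest_of_ne_zero (P := fun j => (E * (j + 1)) ^ p ≤ t) rfl h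

theorem le_powInverse {E p t j : ℕ} (hE : 1 ≤ E) (hp : 1 ≤ p) (h : (E * (j + 1)) ^ p ≤ t) :
    j ≤ powInverse E p t := by
  refine Nat.le_findGreatest ?_ h
  have h1 : E * (j + 1) ≤ (E * (j + 1)) ^ p := Nat.le_self_pow (by omega) _
  have h2 : j + 1 ≤ E * (j + 1) := Nat.le_mul_of_pos_left _ hE
  omega

theorem powInverse_mono {E p : ℕ} (hE : 1 ≤ E) (hp : 1 ≤ p) : Monotone (powInverse E p) := by
  intro t u htu
  rcases Nat.eq_zero_or_pos (powInverse E p t) with h | h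
  · omega
  · exact le_powInverse hE hp ((powInverse_spec E p t (by omega)).trans htu)

/-- Numbers of blocks that can be handled at level `d` with constant of degree `p` in `j`. -/
def blockCount (E p : ℕ) : ℕ → ℕ → ℕ
  | 0, _ => 2
  | _ + 1, 0 => 2
  | d + 1, j + 1 =>
    blockCount E p (d + 1) j * blockCount E p d (powInverse E p (blockCount E p (d + 1) j))
  termination_by d j => (d, j)

section blockCount

variable {E p : ℕ}

theorem blockCount_zero (j : ℕ) : blockCount E p 0 j = 2 := by rw [blockCount]

theorem blockCount_zero_right (d : ℕ) : blockCount E p d 0 = 2 := by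
  cases d <;> rw [blockCount]

theorem blockCount_succ (d j : ℕ) : blockCount E p (d + 1) (j + 1) =
    blockCount E p (d + 1) j *
      blockCount E p d (powInverse E p (blockCount E p (d + 1) j)) := by rw [blockCount]

theorem two_le_blockCount (d j : ℕ) : 2 ≤ blockCount E p d j := by
  induction d generalizing j with
  | zero => rw [blockCount_zero]
  | succ d ih =>
    induction j with
    | zero => rw [blockCount_zero_right]
    | succ j ihj =>
      rw [blockCount_succ]
      have := Nat.mul_le_mul ihj (ih (powInverse E p (blockCount E p (d + 1) j)))
      omega

theorem two_mul_blockCount_le (d j : ℕ) :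
    2 * blockCount E p (d + 1) j ≤ blockCount E p (d + 1) (j + 1) := by
  rw [blockCount_succ, mul_comm]
  exact Nat.mul_le_mul_left _ (two_le_blockCount _ _)

theorem blockCount_mono (d : ℕ) : Monotone (blockCount E p (d + 1)) :=
  monotone_nat_of_le_succ fun j =>
    (Nat.le_mul_of_pos_left _ two_pos).trans (two_mul_blockCount_le d j)

theorem two_pow_le_blockCount (d j : ℕ) : 2 ^ (j + 1) ≤ blockCount E p (d + 1) j := by
  induction j with
  | zero => rw [blockCount_zero_right]; norm_num
  | succ j ih => rw [pow_succ']; exact (Nat.mul_le_mul_left 2 ih).trans (two_mul_blockCount_le d j)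

/-- The square leaves room to invert the power at `2 ^ (x / 2)`, which accounts for the doubling in
`A_1`. -/
theorem exists_pow_le_two_pow (E p : ℕ) :
    ∃ j₀, ∀ x ≥ j₀, ((E * (x + 1)) ^ p) ^ 2 ≤ 2 ^ x := by
  have h := (tendsto_pow_const_div_const_pow_of_one_lt (2 * p) (r := 2) one_lt_two).const_mul
    ((E : ℝ) ^ (2 * p) * 2)
  rw [mul_zero] at h
  have h := (h.comp (Filter.tendsto_add_atTop_nat 1)).eventually_lt_const one_pos
  obtain ⟨j₀, hj⟩ := Filter.eventually_atTop.1 h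
  refine ⟨j₀, fun x hx => ?_⟩
  have := (hj x hx).le
  simp only [Function.comp] at this
  rw [pow_succ (2 : ℝ) x, ← mul_div_assoc, div_le_one (by positivity)] at this
  have h' : (((E * (x + 1)) ^ p) ^ 2 : ℝ) ≤ 2 ^ x := by
    rw [← pow_mul, mul_comm p, mul_pow]
    push_cast at this
    linarith
  exact_mod_cast h'

theorem ackHier_one (n : ℕ) : ackHier 1 n = 2 * n := rfl

theorem ackHier_zero_right (d : ℕ) : ackHier (d + 2) 0 = 1 := rfl

theorem ackHier_succ (d j : ℕ) :
    ackHier (d + 2) (j + 1) = ackHier (d + 1) (ackHier (d + 2) j) :=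
  Function.iterate_succ_apply' _ _ _

/-- Raising `j` by one applies the previous level of `blockCount` to `powInverse` of the current
value, just as `A_{d+2}` iterates `A_{d+1}`. Keeping the shift `j₀` on both sides lets the induction
reproduce itself, with `j₀` uniform in `d`. -/
theorem exists_ackHier_le (hE : 1 ≤ E) (hp : 1 ≤ p) : ∃ j₀, ∀ d j,
    j₀ + ackHier (d + 1) j ≤ powInverse E p (blockCount E p (d + 1) (j₀ + j)) := by
  obtain ⟨j₀, hj₀⟩ := exists_pow_le_two_pow E p
  have key : ∀ d j, j₀ + 1 + 2 * j ≤ powInverse E p (blockCount E p (d + 1) (j₀ + j)) := by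
    intro d j
    refine le_powInverse hE hp (le_trans ?_ (two_pow_le_blockCount _ _))
    refine (Nat.pow_le_pow_iff_left two_ne_zero).1 ((hj₀ _ (by omega)).trans ?_)
    rw [← pow_mul]
    exact Nat.pow_le_pow_right two_pos (by omega)
  refine ⟨j₀, fun d => ?_⟩
  induction d with
  | zero =>
    intro j
    have := key 0 j
    rw [zero_add, ackHier_one]
    rw [zero_add] at this
    omega
  | succ d ih =>
    intro j
    induction j with
    | zero =>
      have := key (d + 1) 0
      rw [ackHier_zero_right]
      omega
    | succ j ihj =>
      rw [ackHier_succ]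
      refine (ih _).trans (powInverse_mono hE hp ((blockCount_mono d ihj).trans ?_))
      rw [← add_assoc, blockCount_succ]
      exact Nat.le_mul_of_pos_left _ (two_pos.trans_le (two_le_blockCount _ _))

end blockCount

/-! ### Linear bounds at every level -/

/-- With `y = E * (j + 1)`, one has `(y + E) ^ s ≥ y ^ s + 3 * y ^ (s - 1)`, and the third copy of
`y ^ (s - 1)` pays for `y ^ (s - 2) + 2`. -/
theorem coefficient_recurrence {E j s : ℕ} (hE : 3 ≤ E) (hs : 4 ≤ s) :
    (E * (j + 1)) ^ s + 2 * (E * (j + 1)) ^ (s - 1) + (E * (j + 1)) ^ (s - 2) + 2 ≤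
      (E * (j + 2)) ^ s := by
  obtain ⟨s, rfl⟩ := Nat.exists_eq_add_of_le' hs
  have e1 : s + 4 - 1 = s + 3 := rfl
  have e2 : s + 4 - 2 = s + 2 := rfl
  rw [e1, e2]
  have hy : E * (j + 2) = E * (j + 1) + E := by ring
  rw [hy]
  set y := E * (j + 1) with hyd
  have hy3 : 3 ≤ y := by nlinarith
  have h1 : y ^ (s + 3) ≤ (y + E) ^ (s + 3) := Nat.pow_le_pow_left (by omega) _
  have h2 : y ^ (s + 3) = y * y ^ (s + 2) := by ring
  have h3 : 1 ≤ y ^ (s + 2) := Nat.one_le_pow _ _ (by omega)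
  have h4 : (y + E) ^ (s + 4) = (y + E) * (y + E) ^ (s + 3) := by ring
  have h5 : (y + E) * y ^ (s + 3) ≤ (y + E) * (y + E) ^ (s + 3) := Nat.mul_le_mul_left _ h1
  have h6 : y ^ (s + 4) = y * y ^ (s + 3) := by ring
  have h7 : 3 * y ^ (s + 3) ≤ E * y ^ (s + 3) := Nat.mul_le_mul_right _ hE
  have h8 : 3 * y ^ (s + 2) ≤ y * y ^ (s + 2) := Nat.mul_le_mul_right _ hy3
  rw [h4, h6]
  rw [add_mul] at h5
  omega

/-- Layers of size `t = blockCount E p (d + 1) j` use the induction on `j`; the layer indices use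
level `d`. The coefficient there is at most `t` by the choice of `powInverse`, so that term costs
only `2 * m`. -/
theorem familyBound_blockCount {r E p : ℕ} (hr : 1 ≤ r) (hE : 3 ≤ E) (hrE : r ≤ E) (d j s m : ℕ)
    (hs : 2 ≤ s) (hsp : s ≤ p) (hm : m ≤ blockCount E p d j) :
    FamilyBound r s (multiplicity s d) m ((E * (j + 1)) ^ s * m) := by
  have small : ∀ d j s m, 2 ≤ s → (s < 4 ∨ m ≤ 2) →
      FamilyBound r s (multiplicity s d) m ((E * (j + 1)) ^ s * m) := by
    intro d j s m hs h
    have hc : s ≠ 0 → r - 1 ≤ (E * (j + 1)) ^ s := fun hs0 => by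
      have h1 : E * (j + 1) ≤ (E * (j + 1)) ^ s := Nat.le_self_pow hs0 _
      have h2 : E ≤ E * (j + 1) := Nat.le_mul_of_pos_right _ (by omega)
      omega
    have hc := Nat.mul_le_mul_right m (hc (by omega))
    by_cases h4 : s < 4
    · obtain rfl | rfl : s = 2 ∨ s = 3 := by omega
      · rw [multiplicity_two]; exact (familyBound_two hr m).mono hc
      · rw [multiplicity_three]; exact (familyBound_three hr m).mono hc
    · obtain ⟨s, rfl⟩ := Nat.exists_eq_add_of_le' (not_lt.1 h4)
      exact FamilyBound.of_le _ ((h.resolve_left h4).trans (two_le_multiplicity (s + 1) d))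
  induction d generalizing j s m with
  | zero =>
    rw [blockCount_zero] at hm
    exact small _ _ _ _ hs (Or.inr hm)
  | succ d ihd =>
    induction j generalizing s m with
    | zero =>
      rw [blockCount_zero_right] at hm
      exact small _ _ _ _ hs (Or.inr hm)
    | succ j ihj =>
      by_cases h4 : s < 4
      · exact small _ _ _ _ hs (Or.inl h4)
      have hco := coefficient_recurrence (j := j) hE (not_lt.1 h4)
      set t := blockCount E p (d + 1) j with ht
      have ht2 : 2 ≤ t := two_le_blockCount _ _
      by_cases hmt : m ≤ t
      · exact (ihj s m hs hsp hmt).mono (Nat.mul_le_mul_right m (by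
          rw [show j + 1 + 1 = j + 2 from rfl]; omega))
      rw [blockCount_succ, ← ht] at hm
      set j' := powInverse E p t with hj'
      obtain ⟨s, rfl⟩ := Nat.exists_eq_add_of_le' (not_lt.1 h4)
      obtain ⟨M, hM⟩ : ∃ M, M = (m + t - 1) / t := ⟨_, rfl⟩
      have hM1 : m ≤ M * t := by
        have := Nat.lt_div_mul_add (a := m + t - 1) (b := t) (by omega)
        rw [← hM] at this
        omega
      have hM2 : M * t ≤ 2 * m := by
        have := Nat.div_mul_le_self (m + t - 1) t
        rw [← hM] at this
        omega
      have hM3 : M ≤ blockCount E p d j' := by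
        rw [hM, ← Nat.lt_succ_iff, Nat.div_lt_iff_lt_mul (by omega), Nat.succ_mul,
          mul_comm _ t]
        omega
      have hN : FamilyBound r (s + 4) (multiplicity (s + 4) d) M (2 * m) := by
        -- Zero is the default of `powInverse`, where its defining inequality may fail. Then there
        -- are at most two layers, too few for the required multiplicity.
        by_cases h0 : j' = 0
        · rw [h0, blockCount_zero_right] at hM3
          exact FamilyBound.of_le _ (hM3.trans (two_le_multiplicity (s + 1) d))
        · refine (ihd j' (s + 4) M (by omega) hsp hM3).mono ?_
          have h1 : (E * (j' + 1)) ^ (s + 4) ≤ (E * (j' + 1)) ^ p :=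
            Nat.pow_le_pow_right (Nat.mul_pos (by omega) (by omega)) hsp
          have h2 := powInverse_spec E p t h0
          calc (E * (j' + 1)) ^ (s + 4) * M ≤ t * M := Nat.mul_le_mul_right _ (h1.trans h2)
            _ = M * t := mul_comm _ _
            _ ≤ 2 * m := hM2
      refine (FamilyBound.recurrence (s := s + 2) (by omega) hM1 (multiplicity_succ s d).ge
        (fun l hl => ihj (s + 4) l (by omega) hsp hl)
        (fun l hl => ihj (s + 3) l (by omega) (by omega) hl)
        (fun l hl => ihj (s + 2) l (by omega) (by omega) hl) hN).mono ?_
      rw [← add_mul]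
      exact Nat.mul_le_mul_right m hco

theorem exists_familyBound (r s : ℕ) (hr : 1 ≤ r) (hs : 2 ≤ s) : ∃ C, ∀ d, 1 ≤ d → ∀ n,
    n ≤ ackFun d → FamilyBound r s (multiplicity s d) (2 * n + 1) (C * (2 * n + 1)) := by
  obtain ⟨j₀, hj₀⟩ := exists_ackHier_le (E := r + 3) (p := s) (by omega) (by omega)
  -- Index `j₀ + 3` reaches `A_d(3)`; two further steps, each at least doubling, reach `2 * n + 1`.
  refine ⟨((r + 3) * (j₀ + 5 + 1)) ^ s, fun d hd n hn => ?_⟩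
  obtain ⟨d, rfl⟩ := Nat.exists_eq_add_of_le' hd
  refine familyBound_blockCount hr (by omega) (by omega) _ _ _ _ hs le_rfl ?_
  have h1 := (hj₀ d 3).trans (powInverse_le _ _ _)
  have h2 := two_mul_blockCount_le (E := r + 3) (p := s) d (j₀ + 3)
  have h3 := two_mul_blockCount_le (E := r + 3) (p := s) d (j₀ + 4)
  have h4 := two_le_blockCount (E := r + 3) (p := s) (d + 1) (j₀ + 3)
  have h5 : n ≤ ackHier (d + 1) 3 := hn
  rw [add_assoc j₀ 3 1] at h2
  rw [add_assoc j₀ 4 1] at h3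
  norm_num at h2 h3
  omega

/-! ### From many large sets to total size -/

/-- Splitting every member of the family into groups of equal size. -/
theorem FamilyBound.sum_card_le {r s K m N : ℕ} (h : FamilyBound r s K m N) (hs : 2 ≤ s)
    {α : Type} {V : Finset α} {X : α → Finset ℕ} (hf : InterleavingFree r s V X)
    (hX : ∀ a ∈ V, X a ⊆ range m) :
    ∑ a ∈ V, (X a).card ≤ (K + 1) * (V.card + N) := by
  classical
  let e : α → ℕ → ℕ := fun a => Nat.nth (· ∈ X a)
  have hfin : ∀ a, {x | x ∈ X a}.Finite := fun a => (X a).finite_toSet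
  have hcard : ∀ a, (hfin a).toFinset.card = (X a).card := fun a => by
    congr 1; ext x; simp
  have hmono : ∀ a i j, i < j → j < (X a).card → e a i < e a j := fun a i j hij hj =>
    Nat.nth_strictMonoOn (hfin a) (Set.mem_Iio.2 (by rw [hcard]; omega))
      (Set.mem_Iio.2 (by rw [hcard]; exact hj)) hij
  have hmem : ∀ a i, i < (X a).card → e a i ∈ X a := fun a i hi =>
    Nat.nth_mem_of_lt_card (hfin a) (by rw [hcard]; exact hi)
  let Y : α × ℕ → Finset ℕ := fun b =>
    (Ico (b.2 * (K + 1)) ((b.2 + 1) * (K + 1))).image (e b.1)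
  let W : Finset (α × ℕ) :=
    V.biUnion (fun a => (range ((X a).card / (K + 1))).image (fun g => (a, g)))
  have hW : ∀ b, b ∈ W ↔ b.1 ∈ V ∧ b.2 < (X b.1).card / (K + 1) := by
    rintro ⟨a, g⟩
    simp only [W, mem_biUnion, mem_image, mem_range, Prod.mk.injEq]
    constructor
    · rintro ⟨a', ha', g', hg', rfl, rfl⟩; exact ⟨ha', hg'⟩
    · rintro ⟨h1, h2⟩; exact ⟨a, h1, g, h2, rfl, rfl⟩
  have hWlt : ∀ b ∈ W, (b.2 + 1) * (K + 1) ≤ (X b.1).card := fun b hb =>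
    (Nat.le_div_iff_mul_le (Nat.succ_pos K)).1 ((hW b).1 hb).2
  have hYX : ∀ b ∈ W, Y b ⊆ X b.1 := by
    intro b hb x hx
    obtain ⟨i, hi, rfl⟩ := mem_image.1 hx
    exact hmem _ _ ((mem_Ico.1 hi).2.trans_le (hWlt b hb))
  have hYc : ∀ b ∈ W, (Y b).card = K + 1 := by
    intro b hb
    rw [card_image_of_injOn, Nat.card_Ico, add_mul]
    · omega
    · intro i hi j hj hij
      have hi := (mem_Ico.1 hi).2.trans_le (hWlt b hb)
      have hj := (mem_Ico.1 hj).2.trans_le (hWlt b hb)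
      rcases lt_trichotomy i j with h' | h' | h'
      · exact absurd hij (hmono _ _ _ h' hj).ne
      · exact h'
      · exact absurd hij (hmono _ _ _ h' hi).ne'
  have hYlt : ∀ b ∈ W, ∀ b' ∈ W, b.1 = b'.1 → b.2 < b'.2 → ∀ x ∈ Y b, ∀ y ∈ Y b', x < y := by
    rintro ⟨a, g⟩ hb ⟨a', g'⟩ hb' (rfl : a = a') hg x hx y hy
    obtain ⟨i, hi, rfl⟩ := mem_image.1 hx
    obtain ⟨j, hj, rfl⟩ := mem_image.1 hy
    have h1 := (mem_Ico.1 hi).2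
    have h2 := (mem_Ico.1 hj).1
    have h3 : (g + 1) * (K + 1) ≤ g' * (K + 1) := Nat.mul_le_mul_right _ hg
    exact hmono _ _ _ (by simp only at *; omega) ((mem_Ico.1 hj).2.trans_le (hWlt _ hb'))
  have hWfree : InterleavingFree r s W Y := by
    intro A hA hAr x hx
    -- Of two groups of the same symbol, one lies entirely before the other, so they cannot be even
    -- two-fold interleaved. Interleaved groups therefore come from distinct symbols.
    have hinj : Set.InjOn Prod.fst (A : Set (α × ℕ)) := by
      intro b hb b' hb' hbb
      have lt : ∀ b ∈ A, ∀ b' ∈ A, b.1 = b'.1 → ¬ b.2 < b'.2 := by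
        intro b hb b' hb' hbb hlt
        have h1 := hx.2 0 1 one_pos hs b' hb' b hb
        have h2 := hYlt b (hA hb) b' (hA hb') hbb hlt _ (hx.1 1 hs b hb) _
          (hx.1 0 (by omega) b' hb')
        omega
      have h1 := lt b hb b' hb' hbb
      have h2 := lt b' hb' b hb hbb.symm
      exact Prod.ext hbb (by omega)
    have hl : ∀ a, ∃ b, a ∈ A.image Prod.fst → b ∈ A ∧ b.1 = a := by
      intro a
      by_cases ha : a ∈ A.image Prod.fst
      · obtain ⟨b, hb⟩ := mem_image.1 ha
        exact ⟨b, fun _ => hb⟩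
      · exact ⟨(a, 0), fun h' => (ha h').elim⟩
    choose l hl using hl
    refine hf (A.image Prod.fst) ?_ ((card_image_of_injOn hinj).trans hAr) (fun i a => x i (l a))
      ⟨fun i hi a ha => ?_, fun i j hij hj a ha b hb => ?_⟩
    · intro a ha
      obtain ⟨b, hb, rfl⟩ := mem_image.1 ha
      exact ((hW b).1 (hA hb)).1
    · obtain ⟨h1, h2⟩ := hl a ha
      have := hYX _ (hA h1) (hx.1 i hi _ h1)
      rwa [h2] at this
    · exact hx.2 i j hij hj _ (hl a ha).1 _ (hl b hb).1
  have hWN := h _ W Y hWfree (fun b hb => (hYX b hb).trans (hX _ ((hW b).1 hb).1))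
    fun b hb => by rw [hYc b hb]; omega
  have hWc : W.card = ∑ a ∈ V, (X a).card / (K + 1) := by
    rw [card_biUnion]
    · refine sum_congr rfl fun a _ => ?_
      rw [card_image_of_injective _ (Prod.mk_right_injective a), card_range]
    · intro a _ b _ hab
      rw [Function.onFun, disjoint_left]
      rintro x hx hx'
      obtain ⟨_, _, rfl⟩ := mem_image.1 hx
      obtain ⟨_, _, h'⟩ := mem_image.1 hx'
      exact hab (Prod.ext_iff.1 h').1.symm
  calc ∑ a ∈ V, (X a).card ≤ ∑ a ∈ V, ((K + 1) + (K + 1) * ((X a).card / (K + 1))) :=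
        sum_le_sum fun a _ => by
          have := Nat.lt_mul_div_succ (X a).card (Nat.succ_pos K)
          rw [Nat.succ_eq_add_one, mul_add, mul_one] at this
          omega
    _ = (K + 1) * (V.card + W.card) := by
        rw [sum_add_distrib, sum_const, smul_eq_mul, ← mul_sum, ← hWc]; ring
    _ ≤ _ := by gcongr

/-! ### Formations in sequences of blocks -/

/-- No subsequence of `S` is an `(r,s)`-formation. -/
def AvoidsFormations (r s : ℕ) (S : List ℕ) : Prop :=
  ∀ L : List ℕ, IsFormation r s L → ¬ L.Sublist S

theorem exists_permutation_sublist {A : Finset ℕ} {l : List ℕ} (h : A ⊆ l.toFinset) :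
    ∃ p : List ℕ, (p.Nodup ∧ p.toFinset = A) ∧ p.Sublist l := by
  refine ⟨(l.filter (· ∈ A)).dedup, ⟨List.nodup_dedup _, ?_⟩,
    (List.dedup_sublist _).trans List.filter_sublist⟩
  ext a
  simp only [List.mem_toFinset, List.mem_dedup, List.mem_filter, decide_eq_true_eq]
  exact ⟨fun h => h.2, fun ha => ⟨List.mem_toFinset.1 (h ha), ha⟩⟩

theorem IsSparse.of_append {r : ℕ} {u T v : List ℕ} (h : IsSparse r (u ++ T ++ v)) :
    IsSparse r T := by
  intro i j hi hj hij hjr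
  have := h (u.length + i) (u.length + j) (by simp; omega) (by simp; omega) (by omega) (by omega)
  simpa [List.getElem_append, hi, hj] using this

theorem IsSparse.nodup {r : ℕ} {T : List ℕ} (h : IsSparse r T) (hT : T.length ≤ r) :
    T.Nodup :=
  List.pairwise_iff_getElem.2 fun i j hi hj hij => h i j hi hj hij (by omega)

/-- Any `r` symbols occurring in `T` already yield an `(r,1)`-formation, so fewer than `r` occur.
Sparsity then forbids length above `r` and any repetition. -/
theorem IsFormationFree.length_le_of_one {r : ℕ} {T : List ℕ} (h : IsFormationFree r 1 T) :
    T.length ≤ T.toFinset.card := by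
  have hlt : T.toFinset.card < r := by
    by_contra hc
    obtain ⟨A, hA, hAr⟩ := exists_subset_card_eq (not_lt.1 hc)
    obtain ⟨p, hp, hpT⟩ := exists_permutation_sublist hA
    exact h.2 p ⟨A, [p], hAr, rfl, by simpa using hp, by simp⟩ hpT
  have hlen : T.length ≤ r := by
    by_contra hc
    have hs : IsSparse r (T.take r) := by
      have h1 := h.1
      rw [← List.take_append_drop r T] at h1
      exact IsSparse.of_append (u := []) (v := T.drop r) (by simpa using h1)
    have hnd := hs.nodup (List.length_take_le _ _)
    have h2 := List.toFinset_card_of_nodup hnd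
    rw [List.length_take_of_le (by omega)] at h2
    have h3 : (T.take r).toFinset ⊆ T.toFinset := fun a ha =>
      List.mem_toFinset.2 (List.mem_of_mem_take (List.mem_toFinset.1 ha))
    have := card_le_card h3
    omega
  rw [List.toFinset_card_of_nodup (h.1.nodup hlen)]

theorem IsFormationFree.succ {r s : ℕ} {S : List ℕ} (h : IsFormationFree r s S) :
    IsFormationFree r (s + 1) S := by
  refine ⟨h.1, ?_⟩
  rintro L ⟨A, P, hA, hP, hp, rfl⟩ hL
  obtain ⟨p, P, rfl⟩ := List.exists_cons_of_length_eq_add_one hP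
  refine h.2 P.flatten ⟨A, P, hA, by simpa using hP, fun q hq => hp q (by simp [hq]), rfl⟩ ?_
  exact (List.sublist_append_right p P.flatten).trans (by simpa using hL)

theorem formation_extend {r s : ℕ} {A : Finset ℕ} {P : List (List ℕ)} {l₁ T l₂ : List ℕ}
    (hA : A.card = r) (hP : P.length = s) (hp : ∀ p ∈ P, p.Nodup ∧ p.toFinset = A)
    (hT : P.flatten.Sublist T) (h₁ : A ⊆ l₁.toFinset) (h₂ : A ⊆ l₂.toFinset) :
    ¬ AvoidsFormations r (s + 2) (l₁ ++ (T ++ l₂)) := by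
  intro h
  obtain ⟨p, hpA, hpl⟩ := exists_permutation_sublist h₁
  obtain ⟨q, hqA, hql⟩ := exists_permutation_sublist h₂
  refine h (p :: (P ++ [q])).flatten ⟨A, p :: (P ++ [q]), hA, by simp [hP], ?_, rfl⟩ ?_
  · intro x hx
    simp only [List.mem_cons, List.mem_append, List.not_mem_nil, or_false] at hx
    rcases hx with rfl | hx | rfl
    exacts [hpA, hp x hx, hqA]
  · simpa using hpl.append (hT.append hql)

/-- The indices of the blocks that contain a symbol. -/
def blockIndices (Us : List (List ℕ)) (a : ℕ) : Finset ℕ :=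
  (range Us.length).filter (fun i => a ∈ Us.getD i [])

theorem mem_flatten_drop_take {Us : List (List ℕ)} {a i w b : ℕ} (h : a ∈ Us.getD i [])
    (hw : w ≤ i) (hb : i < b) : a ∈ ((Us.take b).drop w).flatten := by
  rw [List.getD_eq_getElem?_getD] at h
  cases hU : Us[i]? with
  | none => simp [hU] at h
  | some T =>
    rw [hU, Option.getD_some] at h
    refine List.mem_flatten.2 ⟨T, List.mem_of_getElem? (i := i - w) ?_, h⟩
    rw [List.getElem?_drop, List.getElem?_take, if_pos (by omega), ← hU]
    congr 1
    omega

theorem exists_formation_of_interleaving {Us : List (List ℕ)} {A : Finset ℕ} (hA : A.Nonempty)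
    {x : ℕ → ℕ → ℕ} (s b : ℕ) (hx : IsInterleaving s A (blockIndices Us) x)
    (hb : ∀ i < s, ∀ a ∈ A, x i a < b) :
    ∃ P : List (List ℕ), P.length = s ∧ (∀ p ∈ P, p.Nodup ∧ p.toFinset = A) ∧
      P.flatten.Sublist (Us.take b).flatten := by
  induction s generalizing b with
  | zero => exact ⟨[], rfl, by simp, by simp⟩
  | succ s ih =>
    -- Cut before the first block used by the last round: all earlier rounds lie to its left, the
    -- last round to its right.
    obtain ⟨c, hc, hmin⟩ := exists_min_image A (x s) hA
    obtain ⟨P, hP, hp, hsub⟩ := ih (min (x s c) b)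
      ⟨fun i hi => hx.1 i (by omega), fun i j hij hj => hx.2 i j hij (by omega)⟩
      fun i hi a ha => lt_min (hx.2 i s hi (by omega) a ha c hc) (hb i (by omega) a ha)
    have hcb := hb s (by omega) c hc
    rw [min_eq_left hcb.le] at hsub
    obtain ⟨p, hpA, hpl⟩ := exists_permutation_sublist (A := A)
      (l := ((Us.take b).drop (x s c)).flatten) fun a ha => by
        have := (mem_filter.1 (hx.1 s (by omega) a ha)).2
        exact List.mem_toFinset.2
          (mem_flatten_drop_take this (hmin a ha) (hb s (by omega) a ha))
    refine ⟨P ++ [p], by simp [hP], ?_, ?_⟩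
    · intro q hq
      simp only [List.mem_append, List.mem_cons, List.not_mem_nil, or_false] at hq
      rcases hq with hq | rfl
      exacts [hp q hq, hpA]
    · rw [← List.take_append_drop (x s c) (Us.take b), List.flatten_append, List.take_take,
        min_eq_left hcb.le, List.flatten_append]
      exact hsub.append (by simpa using hpl)

theorem AvoidsFormations.interleavingFree {r s : ℕ} (hr : 1 ≤ r) {Us : List (List ℕ)}
    (h : AvoidsFormations r s Us.flatten) (V : Finset ℕ) :
    InterleavingFree r s V (blockIndices Us) := by
  intro A _ hAr x hx
  obtain ⟨P, hP, hp, hsub⟩ := exists_formation_of_interleaving (card_pos.1 (by omega)) s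
    Us.length hx fun i hi a ha => mem_range.1 (mem_filter.1 (hx.1 i hi a ha)).1
  rw [List.take_length] at hsub
  exact h _ ⟨A, P, hAr, hP, hp, rfl⟩ hsub

theorem avoidsFormations_nil {r s : ℕ} (hr : 1 ≤ r) (hs : 1 ≤ s) : AvoidsFormations r s [] := by
  rintro L ⟨A, P, hA, hP, hp, rfl⟩ hL
  have hL := List.eq_nil_of_sublist_nil hL
  cases P with
  | nil => simp at hP; omega
  | cons p P =>
    have := (hp p (by simp)).2
    simp only [List.flatten_cons, List.append_eq_nil_iff] at hL
    rw [hL.1] at this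
    subst this
    simp at hA
    omega

/-! ### Cutting a sequence into segments -/

/-- Greedy cutting: a segment is closed as soon as it contains an `(r,s)`-formation, so deleting its
last letter removes all of them. -/
theorem exists_segmentation {r s : ℕ} (hr : 1 ≤ r) (hs : 1 ≤ s) (S : List ℕ) :
    ∃ (Ts : List (List ℕ)) (B : List ℕ), S = Ts.flatten ++ B ∧ AvoidsFormations r s B ∧
      ∀ T ∈ Ts, ¬ AvoidsFormations r s T ∧ ∃ B' y, T = B' ++ [y] ∧ AvoidsFormations r s B' := by
  induction S using List.reverseRecOn with
  | nil => exact ⟨[], [], rfl, avoidsFormations_nil hr hs, by simp⟩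
  | append_singleton S y ih =>
    obtain ⟨Ts, B, rfl, hB, hT⟩ := ih
    by_cases h : AvoidsFormations r s (B ++ [y])
    · exact ⟨Ts, B ++ [y], by simp, h, hT⟩
    · refine ⟨Ts ++ [B ++ [y]], [], by simp, avoidsFormations_nil hr hs, ?_⟩
      intro T hT'
      simp only [List.mem_append, List.mem_cons, List.not_mem_nil, or_false] at hT'
      rcases hT' with hT' | rfl
      exacts [hT T hT', ⟨h, B, y, rfl, hB⟩]

theorem flatten_eq_take_getD_drop (Us : List (List ℕ)) (i : ℕ) :
    Us.flatten = (Us.take i).flatten ++ (Us.getD i [] ++ (Us.drop (i + 1)).flatten) := by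
  induction Us generalizing i with
  | nil => simp
  | cons U Us ih =>
    cases i with
    | zero => simp
    | succ i =>
      rw [List.take_succ_cons, List.drop_succ_cons, List.getD_cons_succ, List.flatten_cons,
        List.flatten_cons, List.append_assoc, ← ih]

/-- If every symbol of the formation in a segment occurred in both earlier and later blocks, a
permutation could be added at each end. So each segment is the first or the last block of some
symbol, and a symbol serves at most two segments. -/
theorem card_segments_le {r s : ℕ} (hs : 1 ≤ s) {Us : List (List ℕ)} {k : ℕ}
    (hU : AvoidsFormations r (s + 2) Us.flatten)
    (hk : ∀ i < k, ¬ AvoidsFormations r s (Us.getD i [])) :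
    k ≤ 2 * Us.flatten.toFinset.card := by
  have key : ∀ i, ∃ a, i < k → a ∈ Us.getD i [] ∧
      ((∀ j < i, a ∉ Us.getD j []) ∨ ∀ j > i, a ∉ Us.getD j []) := by
    intro i
    by_cases hi : i < k
    swap
    · exact ⟨0, fun h => (hi h).elim⟩
    by_contra hc
    push Not at hc
    have hki := hk i hi
    rw [AvoidsFormations] at hki
    push Not at hki
    obtain ⟨_, ⟨A, P, hA, hP, hp, rfl⟩, hL⟩ := hki
    have hAi : ∀ a ∈ A, a ∈ Us.getD i [] := by
      intro a ha
      refine hL.subset (List.mem_flatten.2 ?_)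
      obtain ⟨p, hpP⟩ := List.exists_mem_of_length_pos (l := P) (by omega)
      refine ⟨p, hpP, ?_⟩
      rw [← (hp p hpP).2] at ha
      exact List.mem_toFinset.1 ha
    rw [flatten_eq_take_getD_drop Us i] at hU
    refine formation_extend hA hP hp hL (fun a ha => ?_) (fun a ha => ?_) hU
    · obtain ⟨j, hj, hja⟩ := ((hc a).2 (hAi a ha)).1
      have := mem_flatten_drop_take hja (Nat.zero_le j) hj
      exact List.mem_toFinset.2 this
    · obtain ⟨j, hj, hja⟩ := ((hc a).2 (hAi a ha)).2
      have := mem_flatten_drop_take hja hj (lt_max_of_lt_left (c := Us.length)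
        (Nat.lt_succ_self j))
      rw [List.take_of_length_le (le_max_right _ _)] at this
      exact List.mem_toFinset.2 this
  have hmem : ∀ {i a}, a ∈ Us.getD i [] → a ∈ Us.flatten.toFinset := fun {i a} h => by
    rw [flatten_eq_take_getD_drop Us i]
    simp only [List.mem_toFinset, List.mem_append]
    exact Or.inr (Or.inl h)
  classical
  choose f hf using key
  have hcard := card_le_card_of_injOn (s := range k) (t := Us.flatten.toFinset ×ˢ univ)
    (fun i => (f i, decide (∀ j < i, f i ∉ Us.getD j [])))
    (fun i hi => by
      have := (hf i (by simpa using hi)).1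
      exact mem_coe.2 (mem_product.2 ⟨hmem this, mem_univ _⟩)) ?_
  · rw [card_range, card_product, card_univ, Fintype.card_bool] at hcard
    omega
  · have lt : ∀ i < k, ∀ j < k, f i = f j → decide (∀ l < i, f i ∉ Us.getD l []) =
        decide (∀ l < j, f j ∉ Us.getD l []) → ¬ i < j := by
      intro i hi j hj hij hd hlt
      rw [decide_eq_decide] at hd
      obtain ⟨hi1, hi2⟩ := hf i hi
      have hj1 := (hf j hj).1
      rcases hi2 with h | h
      · exact hd.1 h i hlt (hij ▸ hi1)
      · exact h j hlt (hij ▸ hj1)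
    intro i hi j hj hij
    simp only [coe_range, Set.mem_Iio] at hi hj
    obtain ⟨h1, h2⟩ := Prod.ext_iff.1 hij
    have := lt i hi j hj h1 h2
    have := lt j hj i hi h1.symm h2.symm
    omega

theorem length_flatten_eq_sum (Us : List (List ℕ)) :
    Us.flatten.length = ∑ i ∈ range Us.length, (Us.getD i []).length := by
  induction Us with
  | nil => simp
  | cons U Us ih =>
    rw [List.length_cons, sum_range_succ', List.flatten_cons, List.length_append, ih, add_comm]
    simp only [List.getD_cons_succ, List.getD_cons_zero]

theorem sum_card_toFinset_getD (Us : List (List ℕ)) :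
    ∑ i ∈ range Us.length, (Us.getD i []).toFinset.card =
      ∑ a ∈ Us.flatten.toFinset, (blockIndices Us a).card := by
  refine Eq.trans ?_ (sum_card_bipartiteAbove_eq_sum_card_bipartiteBelow
    (s := range Us.length) (t := Us.flatten.toFinset) (fun i a => a ∈ Us.getD i []))
  refine sum_congr rfl fun i _ => congrArg card ?_
  ext a
  simp only [List.mem_toFinset, mem_bipartiteAbove, iff_and_self]
  intro h
  rw [flatten_eq_take_getD_drop Us i]
  simp only [List.mem_append]
  exact Or.inr (Or.inl h)

/-- Cutting a sequence without `(r,s+2)`-formations into segments that are nearly free of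
`(r,s)`-formations. -/
theorem IsFormationFree.length_le {r s n φ K N : ℕ} (hr : 1 ≤ r) (hs : 1 ≤ s)
    (hφ : ∀ T, IsFormationFree r s T → T.toFinset.card ≤ n → T.length ≤ φ * T.toFinset.card)
    (hB : FamilyBound r (s + 2) K (2 * n + 1) N) {S : List ℕ}
    (hS : IsFormationFree r (s + 2) S) (hn : S.toFinset.card = n) :
    S.length ≤ (φ + 1) * ((K + 1) * (n + N)) := by
  obtain ⟨Ts, B, hSeq, hBa, hT⟩ := exists_segmentation hr hs S
  obtain ⟨Us, hUs⟩ : ∃ Us, Us = Ts ++ [B] := ⟨_, rfl⟩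
  have hSU : S = Us.flatten := by simp [hSeq, hUs]
  have hUl : Us.length = Ts.length + 1 := by simp [hUs]
  have hav := hS.2
  change AvoidsFormations r (s + 2) S at hav
  rw [hSU] at hav
  have hk : Ts.length ≤ 2 * n := by
    rw [← hn, hSU]
    refine card_segments_le hs hav fun i hi => ?_
    rw [hUs, List.getD_append _ _ _ _ hi, List.getD_eq_getElem _ _ hi]
    exact (hT _ (List.getElem_mem _)).1
  -- The closing letter of a segment costs one, absorbed by `φ + 1` because the segment has at least
  -- one symbol.
  have hblock : ∀ i ∈ range Us.length,
      (Us.getD i []).length ≤ (φ + 1) * (Us.getD i []).toFinset.card := by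
    intro i hi
    have hi := mem_range.1 hi
    have hsub : ∀ (T u v : List ℕ), Us.getD i [] = u ++ T ++ v → AvoidsFormations r s T →
        T.length ≤ φ * T.toFinset.card := by
      intro T u v hTe hTa
      have hfl := flatten_eq_take_getD_drop Us i
      rw [← hSU, hTe] at hfl
      refine hφ T ⟨?_, hTa⟩ ?_
      · refine IsSparse.of_append (u := (Us.take i).flatten ++ u)
          (v := v ++ (Us.drop (i + 1)).flatten) ?_
        have := hS.1
        rw [hfl] at this
        simpa using this
      · rw [← hn]
        refine card_le_card fun a ha => ?_
        rw [hfl]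
        simp only [List.mem_toFinset, List.mem_append] at ha ⊢
        tauto
    by_cases hiT : i < Ts.length
    · have hg : Us.getD i [] = Ts[i] := by
        rw [hUs, List.getD_append _ _ _ _ hiT, List.getD_eq_getElem _ _ hiT]
      obtain ⟨_, B', y, hBy, hB'⟩ := hT _ (List.getElem_mem hiT)
      rw [hBy] at hg
      have h1 := hsub B' [] [y] (by simpa using hg) hB'
      have h2 : B'.toFinset.card ≤ (B' ++ [y]).toFinset.card :=
        card_le_card fun a ha => by simp only [List.mem_toFinset, List.mem_append] at ha ⊢; tauto
      have h3 : 0 < (B' ++ [y]).toFinset.card := card_pos.2 ⟨y, by simp⟩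
      have h4 := Nat.mul_le_mul_left φ h2
      rw [hg, List.length_append, List.length_singleton, add_mul, one_mul]
      omega
    · have hg : Us.getD i [] = B := by
        obtain rfl : i = Ts.length := by omega
        simp [hUs]
      have h1 := hsub B [] [] (by simpa using hg) hBa
      rw [hg, add_mul]
      omega
  have hsum : ∑ a ∈ Us.flatten.toFinset, (blockIndices Us a).card ≤ (K + 1) * (n + N) := by
    have := hB.sum_card_le (by omega) (hav.interleavingFree hr Us.flatten.toFinset)
      (fun a _ i hi => mem_range.2 (by
        have := mem_range.1 (mem_filter.1 hi).1
        omega))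
    rwa [← hSU, hn, hSU] at this
  calc S.length = ∑ i ∈ range Us.length, (Us.getD i []).length := by
        rw [hSU, length_flatten_eq_sum]
    _ ≤ ∑ i ∈ range Us.length, (φ + 1) * (Us.getD i []).toFinset.card := sum_le_sum hblock
    _ = (φ + 1) * ∑ a ∈ Us.flatten.toFinset, (blockIndices Us a).card := by
        rw [← mul_sum, sum_card_toFinset_getD]
    _ ≤ _ := Nat.mul_le_mul_left _ hsum

/-! ### The inverse Ackermann function and length factors -/

theorem ackHier_growth (d : ℕ) : (∀ j, 1 ≤ j → j + 1 ≤ ackHier (d + 1) j) ∧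
    ∀ j, ackHier (d + 1) j + 1 ≤ ackHier (d + 1) (j + 1) := by
  induction d with
  | zero =>
    simp only [zero_add, ackHier_one]
    exact ⟨fun j hj => by omega, fun j => by omega⟩
  | succ d ih =>
    have h1 : ∀ j, j + 1 ≤ ackHier (d + 2) j := by
      intro j
      induction j with
      | zero => rw [ackHier_zero_right]
      | succ j ihj =>
        rw [ackHier_succ]
        exact (Nat.succ_le_succ ihj).trans (ih.1 _ ((Nat.le_add_left 1 j).trans ihj))
    refine ⟨fun j _ => h1 j, fun j => ?_⟩
    rw [ackHier_succ]
    exact ih.1 _ ((Nat.le_add_left 1 j).trans (h1 j))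

/-- The value 4 at 2 on every level gives `A_{k+1}(3) = A_k(4)`, so `A_k(3)` strictly increases with
`k`. -/
theorem ackHier_at_one_two (d : ℕ) : ackHier (d + 1) 1 = 2 ∧ ackHier (d + 1) 2 = 4 := by
  induction d with
  | zero => exact ⟨rfl, rfl⟩
  | succ d ih =>
    have h1 : ackHier (d + 1 + 1) 1 = 2 := by
      rw [ackHier_succ d 0, ackHier_zero_right]; exact ih.1
    refine ⟨h1, ?_⟩
    rw [ackHier_succ d 1, h1]
    exact ih.2

theorem le_ackFun (d : ℕ) : d + 1 ≤ ackFun (d + 1) := by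
  unfold ackFun
  induction d with
  | zero => rw [zero_add, ackHier_one]; norm_num
  | succ d ih =>
    rw [ackHier_succ d 2, (ackHier_at_one_two (d + 1)).2]
    exact (Nat.succ_le_succ ih).trans ((ackHier_growth d).2 3)

theorem invAck_mem (n : ℕ) : 1 ≤ invAck n ∧ n ≤ ackFun (invAck n) :=
  Nat.sInf_mem (s := {k : ℕ | 1 ≤ k ∧ n ≤ ackFun k})
    ⟨n + 1, by omega, (Nat.le_succ n).trans (le_ackFun n)⟩

theorem invAck_mono : Monotone invAck := fun _ n h =>
  Nat.sInf_le ⟨(invAck_mem n).1, h.trans (invAck_mem n).2⟩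

theorem multiplicity_mono (s : ℕ) : Monotone (multiplicity (s + 2)) := by
  refine monotone_nat_of_le_succ fun d => ?_
  match s with
  | 0 => simp only [zero_add, multiplicity_two, le_refl]
  | 1 => simp only [Nat.reduceAdd, multiplicity_three, le_refl]
  | s + 2 =>
    rw [multiplicity_succ]
    have : 1 ≤ multiplicity (s + 2) (d + 1) := by
      cases s with
      | zero => rw [multiplicity_two]
      | succ s => exact (two_le_multiplicity s (d + 1)).trans' one_le_two
    exact (Nat.le_mul_of_pos_right (multiplicity (s + 4) d) this).trans (Nat.le_add_left _ _)

/-- `F ∘ α` bounds the average multiplicity of a symbol in `(r,s)`-formation-free sequences. -/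
def LengthFactor (r s : ℕ) (F : ℕ → ℕ) : Prop :=
  Monotone F ∧ ∀ S, IsFormationFree r s S →
    S.length ≤ F (invAck S.toFinset.card) * S.toFinset.card

theorem lengthFactor_one (r : ℕ) : LengthFactor r 1 (fun _ => 1) :=
  ⟨monotone_const, fun S hS => by rw [one_mul]; exact hS.length_le_of_one⟩

theorem LengthFactor.of_succ {r s : ℕ} {F : ℕ → ℕ} (h : LengthFactor r (s + 1) F) :
    LengthFactor r s F := ⟨h.1, fun S hS => h.2 S hS.succ⟩

theorem LengthFactor.exists_step {r s : ℕ} {F : ℕ → ℕ} (hr : 1 ≤ r) (hs : 1 ≤ s)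
    (h : LengthFactor r s F) : ∃ D, LengthFactor r (s + 2)
      (fun d => (F d + 1) * ((multiplicity (s + 2) d + 1) * D)) := by
  obtain ⟨C, hC⟩ := exists_familyBound r (s + 2) hr (by omega)
  refine ⟨1 + 3 * C, fun d e hde => ?_, fun S hS => ?_⟩
  · have := h.1 hde
    have := multiplicity_mono s hde
    dsimp only
    gcongr
  obtain ⟨n, hn⟩ : ∃ n, n = S.toFinset.card := ⟨_, rfl⟩
  rw [← hn]
  -- Segments have at most `n` symbols, so monotonicity of `F` and of `invAck` gives them all the
  -- factor at `invAck n`.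
  have hlen := hS.length_le hr hs (n := n) (φ := F (invAck n))
    (fun T hT hTn => (h.2 T hT).trans (Nat.mul_le_mul_right _ (h.1 (invAck_mono hTn))))
    (hC _ (invAck_mem n).1 n (invAck_mem n).2) hn.symm
  rcases Nat.eq_zero_or_pos n with h0 | h0
  · have : S = [] := by
      rw [h0] at hn
      simpa using hn.symm
    simp [this]
  · refine hlen.trans ?_
    rw [mul_assoc, mul_assoc]
    gcongr
    nlinarith [Nat.mul_le_mul_left C (show 2 * n + 1 ≤ 3 * n by omega)]

/-! ### Power sums and logarithms -/

theorem pow_add_le_succ_pow (t d : ℕ) : d ^ (t + 1) + (t + 1) * d ^ t ≤ (d + 1) ^ (t + 1) := by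
  induction t with
  | zero => simp
  | succ t ih =>
    have := Nat.mul_le_mul_right (d + 1) ih
    rw [← pow_succ] at this
    refine le_trans ?_ this
    have e : (d ^ (t + 1) + (t + 1) * d ^ t) * (d + 1) =
      d ^ (t + 1 + 1) + (t + 1 + 1) * d ^ (t + 1) + (t + 1) * d ^ t := by ring
    omega

theorem succ_pow_le_pow_add (t d : ℕ) :
    (d + 1) ^ (t + 1) ≤ d ^ (t + 1) + (t + 1) * (d + 1) ^ t := by
  induction t with
  | zero => simp
  | succ t ih =>
    have h := Nat.mul_le_mul_right (d + 1) ih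
    rw [← pow_succ] at h
    refine h.trans ?_
    have h2 : d ^ (t + 1) ≤ (d + 1) ^ (t + 1) := Nat.pow_le_pow_left (Nat.le_succ d) _
    have e : (d ^ (t + 1) + (t + 1) * (d + 1) ^ t) * (d + 1) =
      d ^ (t + 1 + 1) + d ^ (t + 1) + (t + 1) * (d + 1) ^ (t + 1) := by ring
    rw [e, add_mul (t + 1) 1]
    omega

theorem le_sum_pow (t d : ℕ) :
    (d : ℝ) ^ (t + 1) / (t + 1) ≤ ∑ i ∈ range d, ((i + 1 : ℕ) : ℝ) ^ t := by
  rw [div_le_iff₀ (by positivity)]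
  induction d with
  | zero => simp
  | succ d ih =>
    have h : (((d + 1 : ℕ) : ℝ)) ^ (t + 1) ≤ (d : ℝ) ^ (t + 1) + (t + 1) * ((d + 1 : ℕ) : ℝ) ^ t := by
      exact_mod_cast succ_pow_le_pow_add t d
    rw [sum_range_succ]
    linarith

theorem sum_pow_le (t d : ℕ) :
    ∑ i ∈ range d, ((i + 1 : ℕ) : ℝ) ^ t ≤ (d : ℝ) ^ (t + 1) / (t + 1) + (d : ℝ) ^ t := by
  have key : ∑ i ∈ range d, (i : ℝ) ^ t ≤ (d : ℝ) ^ (t + 1) / (t + 1) := by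
    rw [le_div_iff₀ (by positivity)]
    induction d with
    | zero => simp
    | succ d ih =>
      have h : (d : ℝ) ^ (t + 1) + (t + 1) * (d : ℝ) ^ t ≤ (((d + 1 : ℕ) : ℝ)) ^ (t + 1) := by
        exact_mod_cast pow_add_le_succ_pow t d
      rw [sum_range_succ]
      linarith
  have h1 := sum_range_succ (fun i : ℕ => (i : ℝ) ^ t) d
  rw [sum_range_succ'] at h1
  have h2 : (0 : ℝ) ≤ ((0 : ℕ) : ℝ) ^ t := by positivity
  linarith

theorem logb_two_le_self {x : ℝ} (hx : 1 ≤ x) : Real.logb 2 x ≤ x := by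
  rw [Real.logb_le_iff_le_rpow one_lt_two (by linarith)]
  have h := one_add_mul_self_le_rpow_one_add (s := 1) (by norm_num) hx
  norm_num at h
  linarith

theorem exists_logb_le (c : ℝ) (hc : 0 < c) :
    ∃ b : ℝ, 0 ≤ b ∧ ∀ x : ℝ, 1 ≤ x → Real.logb 2 x ≤ c * x + b := by
  refine ⟨|Real.log (c * Real.log 2)| / Real.log 2, by positivity, fun x hx => ?_⟩
  have h2 : 0 < Real.log 2 := Real.log_pos one_lt_two
  have h := Real.log_le_self (x := x * (c * Real.log 2)) (by positivity)
  rw [Real.log_mul (by positivity) (by positivity)] at h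
  have h3 := neg_abs_le (Real.log (c * Real.log 2))
  rw [Real.logb, div_le_iff₀ h2, add_mul, div_mul_cancel₀ _ h2.ne']
  linarith

theorem two_add_two_mul_le (d : ℕ) (hd : 1 ≤ d) : (2 + 2 * d : ℝ) ≤ 2 ^ (2 * d : ℝ) := by
  have h : (2 + 2 * d) ≤ 4 ^ d := by
    induction d, hd using Nat.le_induction with
    | base => norm_num
    | succ d _ ih => rw [pow_succ]; omega
  rw [Real.rpow_mul two_pos.le, Real.rpow_natCast]
  norm_num
  exact_mod_cast h

/-! ### Growth of the multiplicities -/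

/-- Unrolling the linear recurrence satisfied by the multiplicities. -/
theorem recurrence_le_rpow {q p w : ℕ → ℕ} {u b : ℕ → ℝ} (h0 : q 0 = 2)
    (hq : ∀ d, q (d + 1) = 2 * p (d + 1) + q d * w (d + 1))
    (hw : ∀ d, 1 ≤ d → (w d : ℝ) ≤ 2 ^ u d) (hb : Monotone b) (hb0 : 0 ≤ b 0)
    (hp : ∀ d, 1 ≤ d → (p d : ℝ) ≤ 2 ^ (∑ i ∈ range d, u (i + 1) + b d)) {d : ℕ} (hd : 1 ≤ d) :
    (q d : ℝ) ≤ 2 ^ (∑ i ∈ range d, u (i + 1) + b d + 2 * d) := by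
  -- Each level contributes at most two more copies of the main power through `2 * p`; the initial 2
  -- is `q 0`.
  have key : ∀ d, (q d : ℝ) ≤ 2 ^ (∑ i ∈ range d, u (i + 1) + b d) * (2 + 2 * d) := by
    intro d
    induction d with
    | zero =>
      have := Real.one_le_rpow one_le_two hb0
      simp only [h0, sum_range_zero, zero_add, Nat.cast_zero, mul_zero, add_zero]
      push_cast
      linarith
    | succ d ih =>
      rw [hq]
      push_cast
      have h1 := hp (d + 1) (by omega)
      have h2 := mul_le_mul ih (hw (d + 1) (by omega)) (by positivity) (by positivity)
      have h3 : (2 : ℝ) ^ (∑ i ∈ range d, u (i + 1) + b d) * (2 + 2 * d) * 2 ^ u (d + 1) ≤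
          2 ^ (∑ i ∈ range (d + 1), u (i + 1) + b (d + 1)) * (2 + 2 * d) := by
        rw [mul_right_comm, ← Real.rpow_add two_pos]
        refine mul_le_mul_of_nonneg_right (Real.rpow_le_rpow_of_exponent_le one_le_two ?_)
          (by positivity)
        rw [sum_range_succ]
        have := hb (Nat.le_succ d)
        simp only [Nat.succ_eq_add_one] at this
        linarith
      linarith
  rw [Real.rpow_add two_pos]
  exact (key d).trans (mul_le_mul_of_nonneg_left (two_add_two_mul_le d hd) (by positivity))

/-- Exponent of the multiplicities for even `s = 2 * t + 4`. -/
noncomputable def evenExponent (t d : ℕ) : ℝ := 1 / (t.factorial : ℝ) * (d : ℝ) ^ t * Real.logb 2 (d : ℝ)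

/-- Exponent of the multiplicities for odd `s = 2 * t + 3`. -/
noncomputable def oddExponent (t d : ℕ) : ℝ := 1 / (t.factorial : ℝ) * (d : ℝ) ^ t

theorem logb_natCast_nonneg (d : ℕ) : 0 ≤ Real.logb 2 (d : ℝ) := by
  rcases Nat.eq_zero_or_pos d with rfl | h
  · simp
  · exact Real.logb_nonneg one_lt_two (by exact_mod_cast h)

theorem evenExponent_nonneg (t d : ℕ) : 0 ≤ evenExponent t d :=
  mul_nonneg (by positivity) (logb_natCast_nonneg d)

theorem oddExponent_nonneg (t d : ℕ) : 0 ≤ oddExponent t d := by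
  unfold oddExponent; positivity

theorem one_div_factorial_le_one (t : ℕ) : 1 / (t.factorial : ℝ) ≤ 1 := by
  rw [div_le_one (by positivity)]
  exact_mod_cast t.factorial_pos

theorem oddExponent_le (t d : ℕ) : oddExponent t d ≤ (d : ℝ) ^ t :=
  mul_le_of_le_one_left (by positivity) (one_div_factorial_le_one t)

theorem evenExponent_le (t d : ℕ) (hd : 1 ≤ d) : evenExponent t d ≤ (d : ℝ) ^ (t + 1) := by
  rw [pow_succ]
  exact mul_le_mul (oddExponent_le t d) (logb_two_le_self (by exact_mod_cast hd))
    (logb_natCast_nonneg d) (by positivity)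

theorem one_div_factorial_succ (t : ℕ) :
    1 / ((t + 1).factorial : ℝ) = 1 / (t.factorial : ℝ) * (1 / (t + 1)) := by
  rw [Nat.factorial_succ]; push_cast; field_simp

theorem sum_pow_le_mul (t d : ℕ) :
    ∑ i ∈ range d, ((i + 1 : ℕ) : ℝ) ^ t ≤ (d : ℝ) ^ (t + 1) := by
  have h : ∀ i ∈ range d, ((i + 1 : ℕ) : ℝ) ^ t ≤ (d : ℝ) ^ t := fun i hi =>
    pow_le_pow_left₀ (by positivity) (by exact_mod_cast mem_range.1 hi) _
  have := sum_le_card_nsmul _ _ _ h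
  rw [card_range, nsmul_eq_mul, ← pow_succ'] at this
  exact this

theorem multiplicity_even_step (t : ℕ) {C C' : ℝ} (hC : 0 ≤ C) (hC' : 0 ≤ C')
    (hw : ∀ d, 1 ≤ d → (multiplicity (2 * t + 4) d : ℝ) ≤ 2 ^ (evenExponent t d + C * d ^ t))
    (hp : ∀ d, 1 ≤ d → (multiplicity (2 * t + 5) d : ℝ) ≤
      2 ^ (oddExponent (t + 1) d + C' * d ^ t)) :
    ∃ B : ℝ, 0 ≤ B ∧ ∀ d, 1 ≤ d → (multiplicity (2 * t + 6) d : ℝ) ≤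
      2 ^ (evenExponent (t + 1) d + B * d ^ (t + 1)) := by
  refine ⟨1 + C + (1 + C') + 2, by positivity, fun d hd => ?_⟩
  have hmono : Monotone fun d : ℕ => (1 + C') * (d : ℝ) ^ (t + 1) := fun d e hde => by
    have : (d : ℝ) ≤ e := by exact_mod_cast hde
    dsimp only
    gcongr
  refine (recurrence_le_rpow (multiplicity_zero _) (multiplicity_succ (2 * t + 2)) hw hmono
    (by positivity) (fun d hd => (hp d hd).trans ?_) hd).trans ?_
  · refine Real.rpow_le_rpow_of_exponent_le one_le_two ?_
    have h1 : 0 ≤ ∑ i ∈ range d, (evenExponent t (i + 1) + C * ((i + 1 : ℕ) : ℝ) ^ t) :=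
      sum_nonneg fun i _ => add_nonneg (evenExponent_nonneg _ _) (by positivity)
    have h2 := oddExponent_le (t + 1) d
    have h3 : C' * (d : ℝ) ^ t ≤ C' * (d : ℝ) ^ (t + 1) :=
      mul_le_mul_of_nonneg_left (pow_le_pow_right₀ (by exact_mod_cast hd) (Nat.le_succ t)) hC'
    linarith
  · refine Real.rpow_le_rpow_of_exponent_le one_le_two ?_
    have hd1 : (1 : ℝ) ≤ d := by exact_mod_cast hd
    have hl0 := logb_natCast_nonneg d
    -- Replacing every `log (i + 1)` by `log d` preserves the leading term.
    have h1 : ∑ i ∈ range d, evenExponent t (i + 1) ≤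
        1 / (t.factorial : ℝ) * Real.logb 2 d * ∑ i ∈ range d, ((i + 1 : ℕ) : ℝ) ^ t := by
      rw [mul_sum]
      refine sum_le_sum fun i hi => ?_
      have : Real.logb 2 ((i + 1 : ℕ) : ℝ) ≤ Real.logb 2 d :=
        Real.logb_le_logb_of_le one_lt_two (by positivity) (by exact_mod_cast mem_range.1 hi)
      rw [evenExponent, mul_right_comm]
      gcongr
    have h2 := mul_le_mul_of_nonneg_left (sum_pow_le t d)
      (show 0 ≤ 1 / (t.factorial : ℝ) * Real.logb 2 d by positivity)
    have h3 := mul_le_mul_of_nonneg_left (sum_pow_le_mul t d) hC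
    have h4 : 1 / (t.factorial : ℝ) * Real.logb 2 d * ((d : ℝ) ^ (t + 1) / (t + 1) + (d : ℝ) ^ t) =
        evenExponent (t + 1) d + evenExponent t d := by
      rw [evenExponent, evenExponent, one_div_factorial_succ]; ring
    have h5 := evenExponent_le t d hd
    have h6 : (d : ℝ) ≤ (d : ℝ) ^ (t + 1) := le_self_pow₀ hd1 (by omega)
    rw [sum_add_distrib, ← mul_sum]
    linarith

theorem multiplicity_odd_step (t : ℕ) {C C' : ℝ} (hC : 0 ≤ C) (hC' : 0 ≤ C')
    (hw : ∀ d, 1 ≤ d → (multiplicity (2 * t + 5) d : ℝ) ≤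
      2 ^ (oddExponent (t + 1) d + C * d ^ t))
    (hp : ∀ d, 1 ≤ d → (multiplicity (2 * t + 6) d : ℝ) ≤
      2 ^ (evenExponent (t + 1) d + C' * d ^ (t + 1))) :
    ∃ B : ℝ, 0 ≤ B ∧ ∀ d, 1 ≤ d → (multiplicity (2 * t + 7) d : ℝ) ≤
      2 ^ (oddExponent (t + 2) d + B * d ^ (t + 1)) := by
  -- This slope makes `oddExponent (t + 1) d` times the bound on `log d` have leading term exactly
  -- `oddExponent (t + 2) d`, so the even-order term `p` does not dominate.
  obtain ⟨c, hc, hlog⟩ := exists_logb_le (1 / ((t + 1 : ℕ) + 1)) (by positivity)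
  refine ⟨1 + C + (c + C') + 2, by positivity, fun d hd => ?_⟩
  have hmono : Monotone fun d : ℕ => (c + C') * (d : ℝ) ^ (t + 1) := fun d e hde => by
    have : (d : ℝ) ≤ e := by exact_mod_cast hde
    dsimp only
    gcongr
  have hdist : ∀ d : ℕ, ∑ i ∈ range d, oddExponent (t + 1) (i + 1) =
      1 / ((t + 1).factorial : ℝ) * ∑ i ∈ range d, ((i + 1 : ℕ) : ℝ) ^ (t + 1) := fun d => by
    rw [mul_sum]; rfl
  have hlead : ∀ d : ℕ, 1 / ((t + 1).factorial : ℝ) *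
      ((d : ℝ) ^ (t + 1 + 1) / ((t + 1 : ℕ) + 1)) = oddExponent (t + 2) d := fun d => by
    rw [oddExponent, one_div_factorial_succ (t + 1)]; ring
  refine (recurrence_le_rpow (multiplicity_zero _) (multiplicity_succ (2 * t + 3)) hw hmono
    (by positivity) (fun d hd => (hp d hd).trans ?_) hd).trans ?_
  · refine Real.rpow_le_rpow_of_exponent_le one_le_two ?_
    have h1 : 0 ≤ ∑ i ∈ range d, C * ((i + 1 : ℕ) : ℝ) ^ t :=
      sum_nonneg fun i _ => by positivity
    have h2 := mul_le_mul_of_nonneg_left (le_sum_pow (t + 1) d)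
      (show 0 ≤ 1 / ((t + 1).factorial : ℝ) by positivity)
    rw [hlead] at h2
    have h3 := mul_le_mul_of_nonneg_left (hlog d (by exact_mod_cast hd))
      (oddExponent_nonneg (t + 1) d)
    have h4 : oddExponent (t + 1) d * (1 / ((t + 1 : ℕ) + 1) * (d : ℝ) + c) =
        oddExponent (t + 2) d + c * oddExponent (t + 1) d := by
      rw [← hlead, oddExponent]; ring
    have h5 := mul_le_mul_of_nonneg_left (oddExponent_le (t + 1) d) hc
    have h6 : evenExponent (t + 1) d = oddExponent (t + 1) d * Real.logb 2 d := rfl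
    rw [sum_add_distrib, hdist]
    linarith
  · refine Real.rpow_le_rpow_of_exponent_le one_le_two ?_
    have hd1 : (1 : ℝ) ≤ d := by exact_mod_cast hd
    have h2 := mul_le_mul_of_nonneg_left (sum_pow_le (t + 1) d)
      (show 0 ≤ 1 / ((t + 1).factorial : ℝ) by positivity)
    rw [mul_add, hlead] at h2
    have h3 := mul_le_mul_of_nonneg_left (sum_pow_le_mul t d) hC
    have h5 : 1 / ((t + 1).factorial : ℝ) * (d : ℝ) ^ (t + 1) ≤ (d : ℝ) ^ (t + 1) :=
      oddExponent_le (t + 1) d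
    have h6 : (d : ℝ) ≤ (d : ℝ) ^ (t + 1) := le_self_pow₀ hd1 (by omega)
    rw [sum_add_distrib, hdist, ← mul_sum]
    linarith

theorem multiplicity_four (d : ℕ) : multiplicity 4 d = 4 * d + 2 := by
  induction d with
  | zero => exact multiplicity_zero 0
  | succ d ih =>
    rw [multiplicity_succ 0, zero_add, zero_add, zero_add, multiplicity_three, multiplicity_two, ih]
    ring

theorem multiplicity_five (d : ℕ) : multiplicity 5 d + (8 * d + 20) = 22 * 2 ^ d := by
  induction d with
  | zero => rw [multiplicity_zero 1]; norm_num
  | succ d ih =>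
    have : multiplicity 5 (d + 1) = 2 * multiplicity 4 (d + 1) + multiplicity 5 d * 2 := by
      rw [multiplicity_succ 1]
      exact congrArg (_ + _ * ·) (multiplicity_three (d + 1))
    rw [this, multiplicity_four, pow_succ]
    omega

theorem exists_multiplicity_le (t : ℕ) :
    (∃ C : ℝ, 0 ≤ C ∧ ∀ d, 1 ≤ d → (multiplicity (2 * t + 4) d : ℝ) ≤
      2 ^ (evenExponent t d + C * d ^ t)) ∧
    ∃ C : ℝ, 0 ≤ C ∧ ∀ d, 1 ≤ d → (multiplicity (2 * t + 5) d : ℝ) ≤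
      2 ^ (oddExponent (t + 1) d + C * d ^ t) := by
  induction t with
  | zero =>
    refine ⟨⟨3, by norm_num, fun d hd => ?_⟩, 5, by norm_num, fun d hd => ?_⟩
    · have hd1 : (1 : ℝ) ≤ d := by exact_mod_cast hd
      rw [evenExponent, Real.rpow_add two_pos]
      simp only [Nat.factorial_zero, Nat.cast_one, pow_zero, mul_one, div_one, one_mul]
      rw [Real.rpow_logb two_pos (by norm_num) (by linarith), mul_zero, zero_add,
        multiplicity_four]
      push_cast
      norm_num
      linarith
    · rw [oddExponent, Real.rpow_add two_pos]
      simp only [zero_add, Nat.factorial_one, Nat.cast_one, pow_zero, mul_one, div_one, one_mul,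
        pow_one, mul_zero]
      rw [Real.rpow_natCast]
      have h : multiplicity 5 d ≤ 2 ^ d * 32 := by
        have := multiplicity_five d
        omega
      norm_num
      exact_mod_cast h
  | succ t ih =>
    obtain ⟨⟨C, hC, hw⟩, C', hC', hp⟩ := ih
    have he := multiplicity_even_step t hC hC' hw hp
    obtain ⟨B, hB, hp'⟩ := he
    exact ⟨⟨B, hB, hp'⟩, multiplicity_odd_step t hC' hB hp hp'⟩

/-! ### Length factors and the maximum -/

/-- The previous length factor enters multiplicatively and needs only the crude bound `2 ^ (B * d ^
t)`; the leading exponent `e` comes from the multiplicity alone. -/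
theorem LengthFactor.exists_step_le {r s t : ℕ} {F : ℕ → ℕ} {e : ℕ → ℝ} {B C : ℝ} (hr : 1 ≤ r)
    (hs : 1 ≤ s) (h : LengthFactor r s F) (hB : 0 ≤ B) (hC : 0 ≤ C) (he : ∀ d, 0 ≤ e d)
    (hF : ∀ d, 1 ≤ d → (F d : ℝ) ≤ 2 ^ (B * d ^ t))
    (hm : ∀ d, 1 ≤ d → (multiplicity (s + 2) d : ℝ) ≤ 2 ^ (e d + C * d ^ t)) :
    ∃ F', LengthFactor r (s + 2) F' ∧ ∃ C' : ℝ, 0 ≤ C' ∧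
      ∀ d, 1 ≤ d → (F' d : ℝ) ≤ 2 ^ (e d + C' * d ^ t) := by
  obtain ⟨D, hD⟩ := h.exists_step hr hs
  refine ⟨_, hD, B + 1 + (C + 1 + D), by positivity, fun d hd => ?_⟩
  have hd1 : (1 : ℝ) ≤ (d : ℝ) ^ t := one_le_pow₀ (by exact_mod_cast hd)
  have add_one : ∀ x y : ℝ, 0 ≤ y → x ≤ 2 ^ y → x + 1 ≤ 2 ^ (y + 1) := by
    intro x y hy hxy
    have := Real.one_le_rpow (x := 2) one_le_two hy
    rw [Real.rpow_add two_pos, Real.rpow_one]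
    linarith
  have h1 := add_one _ _ (by positivity) (hF d hd)
  have h2 := add_one _ _ (add_nonneg (he d) (by positivity)) (hm d hd)
  have h3 : (D : ℝ) ≤ 2 ^ (D : ℝ) := by
    rw [Real.rpow_natCast]
    exact_mod_cast Nat.lt_two_pow_self.le
  have h4 := mul_le_mul h1 (mul_le_mul h2 h3 (by positivity) (by positivity)) (by positivity)
    (by positivity)
  push_cast
  refine h4.trans ?_
  rw [← Real.rpow_add two_pos, ← Real.rpow_add two_pos]
  refine Real.rpow_le_rpow_of_exponent_le one_le_two ?_
  nlinarith [mul_le_mul_of_nonneg_left hd1 (Nat.cast_nonneg (α := ℝ) D)]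

theorem exists_lengthFactor_three (r : ℕ) (hr : 1 ≤ r) :
    ∃ F, LengthFactor r 3 F ∧ ∃ B : ℝ, 0 ≤ B ∧ ∀ d, 1 ≤ d → (F d : ℝ) ≤ 2 ^ (B * d ^ 0) := by
  obtain ⟨F, hF, C, hC, hle⟩ := (lengthFactor_one r).exists_step_le (t := 0) (e := fun _ => 0)
    (B := 0) (C := 1) hr le_rfl le_rfl zero_le_one (fun _ => le_rfl) (fun d _ => by simp)
    (fun d _ => by rw [multiplicity_three]; simp)
  exact ⟨F, hF, C, hC, fun d hd => by simpa using hle d hd⟩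

theorem exists_lengthFactor_odd (r t : ℕ) (hr : 1 ≤ r) :
    ∃ F, LengthFactor r (2 * t + 5) F ∧ ∃ C : ℝ, 0 ≤ C ∧
      ∀ d, 1 ≤ d → (F d : ℝ) ≤ 2 ^ (oddExponent (t + 1) d + C * d ^ t) := by
  have weak : ∃ F, LengthFactor r (2 * t + 3) F ∧ ∃ B : ℝ, 0 ≤ B ∧
      ∀ d, 1 ≤ d → (F d : ℝ) ≤ 2 ^ (B * d ^ t) := by
    induction t with
    | zero => exact exists_lengthFactor_three r hr
    | succ t ih =>
      obtain ⟨F, hF, B, hB, hle⟩ := ih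
      obtain ⟨C, hC, hm⟩ := (exists_multiplicity_le t).2
      obtain ⟨F', hF', C', hC', hle'⟩ := hF.exists_step_le hr (by omega) hB hC
        (oddExponent_nonneg (t + 1)) hle hm
      refine ⟨F', hF', 1 + C', by positivity, fun d hd => (hle' d hd).trans ?_⟩
      refine Real.rpow_le_rpow_of_exponent_le one_le_two ?_
      have h2 := oddExponent_le (t + 1) d
      have h3 : C' * (d : ℝ) ^ t ≤ C' * (d : ℝ) ^ (t + 1) :=
        mul_le_mul_of_nonneg_left (pow_le_pow_right₀ (by exact_mod_cast hd) (Nat.le_succ t)) hC'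
      linarith
  obtain ⟨F, hF, B, hB, hle⟩ := weak
  obtain ⟨C, hC, hm⟩ := (exists_multiplicity_le t).2
  exact hF.exists_step_le hr (by omega) hB hC (oddExponent_nonneg (t + 1)) hle hm

theorem exists_lengthFactor_even (r t : ℕ) (hr : 1 ≤ r) :
    ∃ F, LengthFactor r (2 * t + 4) F ∧ ∃ C : ℝ, 0 ≤ C ∧
      ∀ d, 1 ≤ d → (F d : ℝ) ≤ 2 ^ (evenExponent t d + C * d ^ t) := by
  have weak : ∃ F, LengthFactor r (2 * t + 2) F ∧ ∃ B : ℝ, 0 ≤ B ∧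
      ∀ d, 1 ≤ d → (F d : ℝ) ≤ 2 ^ (B * d ^ t) := by
    induction t with
    | zero =>
      -- Avoiding `(r,2)`-formations is stronger than avoiding `(r,3)`-formations, so the factor for
      -- 3 starts the even chain.
      obtain ⟨F, hF, h⟩ := exists_lengthFactor_three r hr
      exact ⟨F, hF.of_succ, h⟩
    | succ t ih =>
      obtain ⟨F, hF, B, hB, hle⟩ := ih
      obtain ⟨C, hC, hm⟩ := (exists_multiplicity_le t).1
      obtain ⟨F', hF', C', hC', hle'⟩ := hF.exists_step_le hr (by omega) hB hC
        (evenExponent_nonneg t) hle hm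
      refine ⟨F', hF', 1 + C', by positivity, fun d hd => (hle' d hd).trans ?_⟩
      refine Real.rpow_le_rpow_of_exponent_le one_le_two ?_
      have h2 := evenExponent_le t d hd
      have h3 : C' * (d : ℝ) ^ t ≤ C' * (d : ℝ) ^ (t + 1) :=
        mul_le_mul_of_nonneg_left (pow_le_pow_right₀ (by exact_mod_cast hd) (Nat.le_succ t)) hC'
      linarith
  obtain ⟨F, hF, B, hB, hle⟩ := weak
  obtain ⟨C, hC, hm⟩ := (exists_multiplicity_le t).1
  exact hF.exists_step_le hr (by omega) hB hC (evenExponent_nonneg t) hle hm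

theorem formationFreeLengths_nonempty {r s : ℕ} (hr : 1 ≤ r) (hs : 2 ≤ s) (n : ℕ) :
    (formationFreeLengths r s n).Nonempty := by
  refine ⟨_, List.range n, ⟨?_, ?_⟩, ?_, rfl⟩
  · intro i j hi hj hij _
    simp only [List.getElem_range]
    exact hij.ne
  · rintro L ⟨A, P, hA, hP, hp, rfl⟩ hL
    have hnd := hL.nodup List.nodup_range
    obtain ⟨a, ha⟩ := card_pos.1 (show 0 < A.card by omega)
    match P, hP, hp, hnd with
    | [], hP, _, _ => simp at hP; omega
    | [_], hP, _, _ => simp at hP; omega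
    | p :: q :: P, _, hp, hnd =>
      have h1 : a ∈ p := List.mem_toFinset.1 ((hp p (by simp)).2 ▸ ha)
      have h2 : a ∈ q := List.mem_toFinset.1 ((hp q (by simp)).2 ▸ ha)
      rw [List.flatten_cons, List.nodup_append'] at hnd
      exact hnd.2.2 h1 (by simp [h2])
  · rw [List.toFinset_card_of_nodup List.nodup_range, List.length_range]

theorem LengthFactor.maxLength_le {r s : ℕ} {F : ℕ → ℕ} (h : LengthFactor r s F) (hr : 1 ≤ r)
    (hs : 2 ≤ s) (n : ℕ) : IsGreatest (formationFreeLengths r s n) (maxLength r s n) ∧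
      maxLength r s n ≤ F (invAck n) * n := by
  have hub : ∀ l ∈ formationFreeLengths r s n, l ≤ F (invAck n) * n := by
    rintro l ⟨S, hS, rfl, rfl⟩
    exact h.2 S hS
  have hmem := Nat.sSup_mem (formationFreeLengths_nonempty hr hs n) ⟨_, hub⟩
  exact ⟨⟨hmem, fun l hl => le_csSup ⟨_, hub⟩ hl⟩, hub _ hmem⟩

theorem LengthFactor.maxLength_le_rpow {r s : ℕ} {F : ℕ → ℕ} (h : LengthFactor r s F)
    (hr : 1 ≤ r) (hs : 2 ≤ s) {e : ℕ → ℝ} (he : ∀ d, 1 ≤ d → (F d : ℝ) ≤ 2 ^ e d) (n : ℕ) :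
    (maxLength r s n : ℝ) ≤ n * 2 ^ e (invAck n) := by
  have h1 : (maxLength r s n : ℝ) ≤ F (invAck n) * n := by
    exact_mod_cast (h.maxLength_le hr hs n).2
  rw [mul_comm]
  exact h1.trans (mul_le_mul_of_nonneg_right (he _ (invAck_mem n).1) (by positivity))

end FormationFree

theorem mainTheorem3 (r s t : ℕ) (hr : 1 ≤ r) (hs : 4 ≤ s) (ht : t = (s - 3) / 2) :
    (∀ n : ℕ, IsGreatest (FormationFree.formationFreeLengths r s n)
      (FormationFree.maxLength r s n)) ∧
    (Odd s → ∃ C : ℝ, ∀ n : ℕ,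
      (FormationFree.maxLength r s n : ℝ) ≤
        n * (2 : ℝ) ^ ((1 / (t.factorial : ℝ)) * (FormationFree.invAck n : ℝ) ^ t
          + C * (FormationFree.invAck n : ℝ) ^ (t - 1))) ∧
    (Even s → ∃ C : ℝ, ∀ n : ℕ,
      (FormationFree.maxLength r s n : ℝ) ≤
        n * (2 : ℝ) ^ ((1 / (t.factorial : ℝ)) * (FormationFree.invAck n : ℝ) ^ t
            * Real.logb 2 (FormationFree.invAck n : ℝ)
          + C * (FormationFree.invAck n : ℝ) ^ t)) := by
  rcases Nat.even_or_odd s with ⟨u, hu⟩ | ⟨u, hu⟩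
  · obtain rfl : s = 2 * t + 4 := by omega
    obtain ⟨F, hF, C, -, hle⟩ := FormationFree.exists_lengthFactor_even r t hr
    refine ⟨fun n => (hF.maxLength_le hr (by omega) n).1, fun hodd => ?_, fun _ => ⟨C, ?_⟩⟩
    · exact absurd ⟨u, hu⟩ (Nat.not_even_iff_odd.2 hodd)
    · exact hF.maxLength_le_rpow hr (by omega) hle
  -- An odd `s ≥ 4` is at least 5, so `t ≥ 1` and `t - 1` is not truncated.
  · obtain ⟨t, rfl⟩ := Nat.exists_eq_add_of_le' (show 1 ≤ t by omega)
    obtain rfl : s = 2 * t + 5 := by omega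
    obtain ⟨F, hF, C, -, hle⟩ := FormationFree.exists_lengthFactor_odd r t hr
    refine ⟨fun n => (hF.maxLength_le hr (by omega) n).1, fun _ => ⟨C, ?_⟩, fun heven => ?_⟩
    · exact hF.maxLength_le_rpow hr (by omega) hle
    · exact absurd ⟨u, hu⟩ (Nat.not_odd_iff_even.2 heven)
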